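/- Let $K$ be an algebraically closed field of characteristic zero, let $n\ge 0$, and let $\preceq$ be a total order on $\mathbb{R}^n$ that is compatible with the group structure and for which the first orthant $(\mathbb{R}_{\ge 0})^n$ is non-negative. For an integer $k\ge 1$ let $K_\preceq[[X]]_k$ be the ring of all formal series $\sum_\gamma a_\gamma X^\gamma$ ($a_\gamma\in K$) with support in $\sigma\cap\frac1k\mathbb{Z}^n$ for some convex polyhedral rational cone $\sigma\subset\{v\in\mathbb{R}^n : v\succeq 0\}$. Put $K_\preceq[[X]]:=K_\preceq[[X]]_1\supset K[[X]]=K[[x_1,\dots,x_n]]$ and $\mathcal{A}_\preceq:=\bigcup_{k\ge 1}K_\preceq[[X]]_k$, and let $K_\preceq((X))$, $K_\preceq((X))_k$ and $\mathcal{S}_\preceq$ be the sets of the series $\varphi$ such that $X^\gamma\varphi$ lies in $K_\preceq[[X]]$, $K_\preceq[[X]]_k$, respectively $\mathcal{A}_\preceq$, for some $\gamma\in\mathbb{Z}^n$. Let $f\in K[[X]][y]$ be a nonzero polynomial. Assume that $f$ is monic in $y$, or that $\preceq$ is compatible with the vector space structure of $\mathbb{R}^n$ (that is, $v\succeq 0$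 and $c>0$ imply $cv\succeq 0$). A $\preceq$-branch of $f$ is the set of roots in $\mathcal{S}_\preceq$ of an irreducible element $g\in K_\preceq[[X]][y]$ that divides $f$ in $K_\preceq[[X]][y]$. Let $\xi\in\mathcal{S}_\preceq$ be a root of $f$, let $k\ge 1$ be such that $f$ is a product of polynomials of degree at most one in $K_\preceq[[X]]_k[y]$, and let $\eta\in K$ be a primitive $k$-th root of unity. For $\mu\in\{0,\dots,k-1\}^n$ let $\tau_{\eta,\mu}:K_\preceq((X))_k\to K_\preceq((X))_k$ be the map $$\varphi(x_1^{1/k},\dots,x_n^{1/k})\mapsto\varphi(\eta^{\mu_1}x_1^{1/k},\dots,\eta^{\mu_n}x_n^{1/k}),$$ that is, $\sum_\gamma a_\gamma X^\gamma\mapsto\sum_\gamma \eta^{\,k(\mu_1\gamma_1+\dots+\mu_n\gamma_n)}a_\gamma X^\gamma$. Then $\xi\in K_\preceq((X))_k$; there is exactly one $\preceq$-branch of $f$ that contains $\xi$, and it is the set $$B(\xi)=\{\tau_{\eta,\mu}(\xi)\ ;\ \mu\in\{0,\dots,k-1\}^n\}.$$ Moreover, $B(\xi)$ is the orbit of $\xi$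 under the group of all automorphisms of $K_\preceq((X))_k$ that fix every element of $K_\preceq((X))$. -/

import Mathlib

namespace ConeSeries

/-- A total order `⪯` on `ℝⁿ`, compatible with the group structure, for which the first orthant
is non-negative. -/
structure OrthantOrder (n : ℕ) where
  /-- the relation `⪯` -/
  le : (Fin n → ℝ) → (Fin n → ℝ) → Prop
  le_refl : ∀ v, le v v
  le_trans : ∀ u v w, le u v → le v w → le u w
  le_antisymm : ∀ u v, le u v → le v u → u = v
  le_total : ∀ u v, le u v ∨ le v u
  add_le_add : ∀ u v w, le u v → le (u + w) (v + w)
  orthant_nonneg : ∀ v, (∀ i, 0 ≤ v i) → le 0 v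

/-- `⪯` is compatible with the real vector space structure as well: multiplication by positive
scalars preserves it. -/
def OrthantOrder.IsVectorOrder {n : ℕ} (O : OrthantOrder n) : Prop :=
  ∀ (c : ℝ) (v : Fin n → ℝ), 0 < c → O.le 0 v → O.le 0 (c • v)

/-- The inclusion `ℚⁿ ⊆ ℝⁿ`. -/
def realVec {n : ℕ} (γ : Fin n → ℚ) : Fin n → ℝ := fun i => (γ i : ℝ)

lemma realVec_add {n : ℕ} (γ δ : Fin n → ℚ) : realVec (γ + δ) = realVec γ + realVec δ := by
  funext i; simp [realVec]

lemma realVec_zero {n : ℕ} : realVec (0 : Fin n → ℚ) = 0 := by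
  funext i; simp [realVec]

lemma realVec_injective {n : ℕ} : Function.Injective (realVec (n := n)) := by
  intro a b h
  funext i
  have := congrFun h i
  simpa [realVec] using this

/-- The group `ℚⁿ` of exponents, ordered by the restriction of `⪯`. -/
def Exponent {n : ℕ} (_O : OrthantOrder n) : Type := Fin n → ℚ

instance {n : ℕ} (O : OrthantOrder n) : AddCommGroup (Exponent O) :=
  inferInstanceAs (AddCommGroup (Fin n → ℚ))

noncomputable instance {n : ℕ} (O : OrthantOrder n) : LinearOrder (Exponent O) where
  le γ δ := O.le (realVec γ) (realVec δ)
  le_refl γ := O.le_refl _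
  le_trans _ _ _ h₁ h₂ := O.le_trans _ _ _ h₁ h₂
  le_antisymm _ _ h₁ h₂ := realVec_injective (O.le_antisymm _ _ h₁ h₂)
  le_total _ _ := O.le_total _ _
  toDecidableLE := Classical.decRel _

instance {n : ℕ} (O : OrthantOrder n) : IsOrderedAddMonoid (Exponent O) where
  add_le_add_left a b h c := by
    let a' : Fin n → ℚ := a
    let b' : Fin n → ℚ := b
    let c' : Fin n → ℚ := c
    have key : O.le (realVec (a' + c')) (realVec (b' + c')) := by
      rw [realVec_add, realVec_add]
      exact O.add_le_add _ _ _ h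
    exact key

/-- An exponent as a vector of rational numbers. -/
def Exponent.vec {n : ℕ} {O : OrthantOrder n} (γ : Exponent O) : Fin n → ℚ := γ

/-- A vector of rational numbers as an exponent. -/
def toExponent {n : ℕ} (O : OrthantOrder n) (γ : Fin n → ℚ) : Exponent O := γ

/-- Convex polyhedral rational cones `⟨u₁, …, u_s⟩ ⊆ ℝⁿ`, with `u₁, …, u_s ∈ ℚⁿ`. -/
def IsRationalCone {n : ℕ} (σ : Set (Fin n → ℝ)) : Prop :=
  ∃ (s : ℕ) (u : Fin s → Fin n → ℚ),
    σ = {v | ∃ c : Fin s → ℝ, (∀ i, 0 ≤ c i) ∧ v = ∑ i, c i • realVec (u i)}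

/-- `γ ∈ (1/k)ℤⁿ` (for `k > 0`). -/
def IsKIntegral {n : ℕ} (k : ℕ) (γ : Fin n → ℚ) : Prop :=
  ∀ i, ∃ m : ℤ, (k : ℚ) * γ i = m

/-- A rational cone contained in `(ℝⁿ)_{⪰ 0}`. -/
def IsNonnegCone {n : ℕ} (O : OrthantOrder n) (σ : Set (Fin n → ℝ)) : Prop :=
  IsRationalCone σ ∧ ∀ v ∈ σ, O.le 0 v

lemma IsRationalCone.zero_mem {n : ℕ} {σ : Set (Fin n → ℝ)} (h : IsRationalCone σ) :
    (0 : Fin n → ℝ) ∈ σ := by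
  obtain ⟨s, u, rfl⟩ := h
  exact ⟨0, by simp, by simp⟩

lemma IsRationalCone.add_mem {n : ℕ} {σ : Set (Fin n → ℝ)} (h : IsRationalCone σ)
    {v w : Fin n → ℝ} (hv : v ∈ σ) (hw : w ∈ σ) : v + w ∈ σ := by
  obtain ⟨s, u, rfl⟩ := h
  obtain ⟨c, hc, rfl⟩ := hv
  obtain ⟨d, hd, rfl⟩ := hw
  refine ⟨c + d, fun i => add_nonneg (hc i) (hd i), ?_⟩
  simp [add_smul, Finset.sum_add_distrib]

lemma IsNonnegCone.exists_sup {n : ℕ} {O : OrthantOrder n} {σ τ : Set (Fin n → ℝ)}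
    (hσ : IsNonnegCone O σ) (hτ : IsNonnegCone O τ) :
    ∃ ρ, IsNonnegCone O ρ ∧ σ ⊆ ρ ∧ τ ⊆ ρ := by
  obtain ⟨⟨s, u, rfl⟩, hu⟩ := hσ
  obtain ⟨⟨t, w, rfl⟩, hw⟩ := hτ
  refine ⟨_, ⟨⟨s + t, Fin.append u w, rfl⟩, ?_⟩, ?_, ?_⟩
  · rintro v ⟨c, hc, rfl⟩
    rw [Fin.sum_univ_add]
    have h₁ := hu _ ⟨fun i => c (Fin.castAdd t i), fun i => hc _, rfl⟩
    have h₂ := hw _ ⟨fun i => c (Fin.natAdd s i), fun i => hc _, rfl⟩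
    have h₃ := O.add_le_add _ _ (∑ i, c (Fin.natAdd s i) • realVec (w i)) h₁
    rw [zero_add] at h₃
    simpa using O.le_trans _ _ _ h₂ h₃
  · rintro v ⟨c, hc, rfl⟩
    refine ⟨Fin.append c 0, ?_, ?_⟩
    · intro i
      refine Fin.addCases (fun j => ?_) (fun j => ?_) i <;> simp [hc]
    · rw [Fin.sum_univ_add]; simp
  · rintro v ⟨c, hc, rfl⟩
    refine ⟨Fin.append 0 c, ?_, ?_⟩
    · intro i
      refine Fin.addCases (fun j => ?_) (fun j => ?_) i <;> simp [hc]
    · rw [Fin.sum_univ_add]; simp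

/-- The first orthant. -/
def orthant (n : ℕ) : Set (Fin n → ℝ) := {v | ∀ i, 0 ≤ v i}

lemma isNonnegCone_orthant {n : ℕ} (O : OrthantOrder n) : IsNonnegCone O (orthant n) := by
  refine ⟨⟨n, fun i => Pi.single i 1, ?_⟩, fun v hv => O.orthant_nonneg v hv⟩
  have key : ∀ c : Fin n → ℝ, ∑ i, c i • realVec (Pi.single i (1 : ℚ)) = c := by
    intro c
    funext j
    simp only [Finset.sum_apply, Pi.smul_apply, realVec, Pi.single_apply, smul_eq_mul]
    rw [Finset.sum_eq_single j]
    · simp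
    · intro i _ hij
      simp [hij.symm]
    · simp
  ext v
  constructor
  · intro hv
    exact ⟨v, hv, (key v).symm⟩
  · rintro ⟨c, hc, rfl⟩
    rw [key]
    exact hc

lemma IsKIntegral.add {n k : ℕ} {γ δ : Fin n → ℚ} (h₁ : IsKIntegral k γ)
    (h₂ : IsKIntegral k δ) : IsKIntegral k (γ + δ) := by
  intro i
  obtain ⟨a, ha⟩ := h₁ i
  obtain ⟨b, hb⟩ := h₂ i
  exact ⟨a + b, by simp [mul_add, ha, hb]⟩

lemma IsKIntegral.mul_left {n k : ℕ} {γ : Fin n → ℚ} (h : IsKIntegral k γ) (l : ℕ) :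
    IsKIntegral (l * k) γ := by
  intro i
  obtain ⟨a, ha⟩ := h i
  exact ⟨l * a, by push_cast; rw [mul_assoc, ha]⟩

/-- Every set of points of `(1/k)ℤⁿ` in a rational cone `σ ⊆ (ℝⁿ)_{⪰ 0}` is well ordered by `⪯`:
arbitrary formal series with such exponents are Hahn series. -/
lemma isPWO_of_subset_cone {n : ℕ} {O : OrthantOrder n} {σ : Set (Fin n → ℝ)}
    (hσ : IsNonnegCone O σ) {k : ℕ} (hk : 0 < k) (S : Set (Exponent O))
    (hS : ∀ γ ∈ S, realVec γ.vec ∈ σ ∧ IsKIntegral k γ.vec) : S.IsPWO := by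
  obtain ⟨⟨s, u, rfl⟩, hpos⟩ := hσ
  -- a common denominator of the generators
  obtain ⟨D, hD, hDu⟩ : ∃ D : ℕ, 0 < D ∧ ∀ i j, ∃ m : ℤ, (D : ℚ) * u i j = m := by
    refine ⟨∏ i, ∏ j, (u i j).den,
      Finset.prod_pos fun i _ => Finset.prod_pos fun j _ => (u i j).den_pos, fun i j => ?_⟩
    obtain ⟨e, he⟩ : (u i j).den ∣ ∏ i, ∏ j, (u i j).den :=
      (Finset.dvd_prod_of_mem (fun j => (u i j).den) (Finset.mem_univ j)).trans
        (Finset.dvd_prod_of_mem (fun i => ∏ j, (u i j).den) (Finset.mem_univ i))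
    refine ⟨e * (u i j).num, ?_⟩
    rw [he]
    push_cast
    rw [mul_comm ((u i j).den : ℚ), mul_assoc, Rat.den_mul_eq_num]
  choose w hw using hDu
  have hDR : (0 : ℝ) < D := by exact_mod_cast hD
  have hwR : ∀ i j, (D : ℝ) * (u i j : ℝ) = (w i j : ℝ) := by
    intro i j
    exact_mod_cast congrArg (fun q : ℚ => (q : ℝ)) (hw i j)
  set W : Fin s → Exponent O := fun i => toExponent O fun j => (w i j : ℚ) with hWdef
  have hW : ∀ i, 0 ≤ W i := by
    intro i
    have h := hpos ((D : ℝ) • realVec (u i))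
      ⟨Pi.single i (D : ℝ), fun l => by
        by_cases hl : l = i
        · subst hl; simp
        · simp [hl], by
        rw [Finset.sum_eq_single i]
        · simp
        · intro l _ hl
          simp [hl]
        · simp⟩
    have e : (D : ℝ) • realVec (u i) = realVec (fun j => (w i j : ℚ)) := by
      funext j
      simp [realVec, hwR]
    rw [e, ← realVec_zero] at h
    exact h
  -- the finite set of the remainders
  let N : ℕ := k * ∑ i, ∑ j, (w i j).natAbs
  let T : Set (Exponent O) :=
    (fun m : Fin n → ℤ => toExponent O fun j => (m j : ℚ) / k) ''
      Set.Icc (fun _ => -(N : ℤ)) (fun _ => (N : ℤ))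
  have hT : T.Finite := (Set.finite_Icc _ _).image _
  have hM : Set.IsPWO (AddSubmonoid.closure (Set.range W) : Set (Exponent O)) :=
    Set.IsPWO.addSubmonoid_closure (by rintro _ ⟨i, rfl⟩; exact hW i)
      (Set.finite_range W).isPWO
  refine (hT.isPWO.add hM).mono fun γ hγ => ?_
  obtain ⟨⟨c, hc, hcγ⟩, hint⟩ := hS γ hγ
  choose p hp using hint
  have hkQ : (k : ℚ) ≠ 0 := by exact_mod_cast hk.ne'
  have hkR : (0 : ℝ) < k := by exact_mod_cast hk
  let a : Fin s → ℕ := fun i => ⌊c i / D⌋₊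
  have ha : ∀ i, 0 ≤ c i / D - a i ∧ c i / D - a i ≤ 1 := fun i =>
    ⟨sub_nonneg.mpr (Nat.floor_le (div_nonneg (hc i) hDR.le)), by
      have := (Nat.lt_floor_add_one (c i / D)).le
      simp only [a]
      linarith⟩
  let q : Fin n → ℤ := fun j => p j - k * ∑ i, (a i : ℤ) * w i j
  have hγj : ∀ j, (γ.vec j : ℝ) = ∑ i, c i / D * (w i j : ℝ) := by
    intro j
    have := congrFun hcγ j
    simp only [realVec, Finset.sum_apply, Pi.smul_apply, smul_eq_mul] at this
    rw [this]
    refine Finset.sum_congr rfl fun i _ => ?_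
    rw [← hwR]
    field_simp
  have hqR : ∀ j, (q j : ℝ) = k * ∑ i, (c i / D - a i) * (w i j : ℝ) := by
    intro j
    have h1 : (p j : ℝ) = k * (γ.vec j : ℝ) := by
      exact_mod_cast congrArg (fun q : ℚ => (q : ℝ)) (hp j).symm
    simp only [q]
    push_cast
    rw [h1, hγj]
    simp only [sub_mul, Finset.sum_sub_distrib]
    ring
  have hqN : ∀ j, |q j| ≤ (N : ℤ) := by
    intro j
    have h1 : |(q j : ℝ)| ≤ (N : ℝ) := by
      rw [hqR, abs_mul, abs_of_pos hkR]
      simp only [N]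
      push_cast
      refine mul_le_mul_of_nonneg_left ?_ hkR.le
      refine (Finset.abs_sum_le_sum_abs _ _).trans (Finset.sum_le_sum fun i _ => ?_)
      rw [abs_mul, abs_of_nonneg (ha i).1]
      have h2 : |(w i j : ℝ)| ≤ ∑ j, |(w i j : ℝ)| :=
        Finset.single_le_sum (f := fun j => |(w i j : ℝ)|) (fun _ _ => abs_nonneg _)
          (Finset.mem_univ j)
      have h3 : (c i / D - a i) * |(w i j : ℝ)| ≤ |(w i j : ℝ)| :=
        mul_le_of_le_one_left (abs_nonneg _) (ha i).2
      simpa [Nat.cast_natAbs] using h3.trans h2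
    exact_mod_cast h1
  refine ⟨toExponent O fun j => (q j : ℚ) / k, ⟨q, ⟨fun j => (abs_le.mp (hqN j)).1,
    fun j => (abs_le.mp (hqN j)).2⟩, rfl⟩, ∑ i, a i • W i,
    sum_mem fun i _ => nsmul_mem (AddSubmonoid.subset_closure (Set.mem_range_self i)) _, ?_⟩
  have hsum : (∑ i, a i • W i : Exponent O) =
      (∑ i, a i • (fun j => (w i j : ℚ)) : Fin n → ℚ) := rfl
  funext j
  change (q j : ℚ) / k + (∑ i, a i • W i : Exponent O).vec j = γ.vec j
  rw [hsum]
  change (q j : ℚ) / k + (∑ i, a i • (fun j => (w i j : ℚ)) : Fin n → ℚ) j = γ.vec j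
  have h1 : (q j : ℚ) = k * γ.vec j - k * ∑ i, (a i : ℚ) * w i j := by
    simp only [q]
    push_cast
    rw [hp]
  rw [h1, Finset.sum_apply]
  simp only [Pi.smul_apply, nsmul_eq_mul]
  field_simp
  ring

/-- The exponent with the given natural coordinates. -/
def natExponent {n : ℕ} (O : OrthantOrder n) (m : Fin n →₀ ℕ) : Exponent O :=
  toExponent O fun i => (m i : ℚ)

/-- The series `φ` has its support in `σ ∩ (1/k)ℤⁿ`. -/
def SupportedIn {n : ℕ} {O : OrthantOrder n} {K : Type*} [Field K]
    (σ : Set (Fin n → ℝ)) (k : ℕ) (φ : HahnSeries (Exponent O) K) : Prop :=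
  ∀ γ, φ.coeff γ ≠ 0 → realVec γ.vec ∈ σ ∧ IsKIntegral k γ.vec

/-- The ring `K_⪯[[X]]_k = K_⪯[[x₁^{1/k}, …, x_n^{1/k}]]` of the series with support in
`σ ∩ (1/k)ℤⁿ` for some rational cone `σ ⊆ (ℝⁿ)_{⪰ 0}`. For `k = 1` it is `K_⪯[[X]]`. -/
def powRing {n : ℕ} (O : OrthantOrder n) (K : Type*) [Field K] (k : ℕ) :
    Subring (HahnSeries (Exponent O) K) where
  carrier := {φ | ∃ σ, IsNonnegCone O σ ∧ SupportedIn σ k φ}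
  zero_mem' := ⟨_, isNonnegCone_orthant O, fun γ h => absurd rfl h⟩
  one_mem' := by
    refine ⟨_, isNonnegCone_orthant O, fun γ h => ?_⟩
    have hγ : γ = 0 := by
      by_contra hne
      exact h (by simp [HahnSeries.coeff_one, hne])
    subst hγ
    refine ⟨?_, fun i => ⟨0, ?_⟩⟩
    · change realVec (0 : Fin n → ℚ) ∈ _
      rw [realVec_zero]
      exact (isNonnegCone_orthant O).1.zero_mem
    · change (k : ℚ) * (0 : Fin n → ℚ) i = _
      simp
  neg_mem' := by
    rintro φ ⟨σ, hσ, h⟩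
    exact ⟨σ, hσ, fun γ hγ => h γ (by simpa using hγ)⟩
  add_mem' := by
    rintro φ ψ ⟨σ, hσ, h⟩ ⟨τ, hτ, h'⟩
    obtain ⟨ρ, hρ, h₁, h₂⟩ := hσ.exists_sup hτ
    refine ⟨ρ, hρ, fun γ hγ => ?_⟩
    by_cases h0 : φ.coeff γ = 0
    · have : ψ.coeff γ ≠ 0 := by simpa [h0] using hγ
      exact ⟨h₂ (h' γ this).1, (h' γ this).2⟩
    · exact ⟨h₁ (h γ h0).1, (h γ h0).2⟩
  mul_mem' := by
    rintro φ ψ ⟨σ, hσ, h⟩ ⟨τ, hτ, h'⟩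
    obtain ⟨ρ, hρ, h₁, h₂⟩ := hσ.exists_sup hτ
    refine ⟨ρ, hρ, fun γ hγ => ?_⟩
    obtain ⟨a, ha, b, hb, rfl⟩ := HahnSeries.support_mul_subset (show γ ∈ (φ * ψ).support from hγ)
    refine ⟨?_, (h a ha).2.add (h' b hb).2⟩
    change realVec (a.vec + b.vec) ∈ ρ
    rw [realVec_add]
    exact hρ.1.add_mem (h₁ (h a ha).1) (h₂ (h' b hb).1)

lemma powRing_le {n : ℕ} (O : OrthantOrder n) (K : Type*) [Field K] (k l : ℕ) :
    powRing O K k ≤ powRing O K (l * k) := by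
  rintro φ ⟨σ, hσ, h⟩
  exact ⟨σ, hσ, fun γ hγ => ⟨(h γ hγ).1, (h γ hγ).2.mul_left l⟩⟩

lemma powRing_one_le {n : ℕ} (O : OrthantOrder n) (K : Type*) [Field K] (k : ℕ) :
    powRing O K 1 ≤ powRing O K k := by
  simpa using powRing_le O K 1 k

/-- The union `𝒜_⪯` of the rings `K_⪯[[X]]_k`, `k > 0`. -/
def unionRing {n : ℕ} (O : OrthantOrder n) (K : Type*) [Field K] :
    Subring (HahnSeries (Exponent O) K) where
  carrier := {φ | ∃ k : ℕ, 0 < k ∧ φ ∈ powRing O K k}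
  zero_mem' := ⟨1, one_pos, zero_mem _⟩
  one_mem' := ⟨1, one_pos, one_mem _⟩
  neg_mem' := by
    rintro φ ⟨k, hk, h⟩
    exact ⟨k, hk, neg_mem h⟩
  add_mem' := by
    rintro φ ψ ⟨k, hk, h⟩ ⟨l, hl, h'⟩
    exact ⟨l * k, Nat.mul_pos hl hk, add_mem (powRing_le O K k l h)
      (mul_comm k l ▸ powRing_le O K l k h')⟩
  mul_mem' := by
    rintro φ ψ ⟨k, hk, h⟩ ⟨l, hl, h'⟩
    exact ⟨l * k, Nat.mul_pos hl hk, mul_mem (powRing_le O K k l h)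
      (mul_comm k l ▸ powRing_le O K l k h')⟩

lemma powRing_le_unionRing {n : ℕ} (O : OrthantOrder n) (K : Type*) [Field K] {k : ℕ}
    (hk : 0 < k) : powRing O K k ≤ unionRing O K :=
  fun _ h => ⟨k, hk, h⟩

/-- The monomial `X^γ`, for `γ ∈ ℤⁿ`. -/
noncomputable def monom {n : ℕ} (O : OrthantOrder n) (K : Type*) [Field K] (γ : Fin n → ℤ) :
    HahnSeries (Exponent O) K :=
  HahnSeries.single (toExponent O fun i => (γ i : ℚ)) 1

lemma monom_add {n : ℕ} (O : OrthantOrder n) (K : Type*) [Field K] (γ δ : Fin n → ℤ) :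
    monom O K (γ + δ) = monom O K γ * monom O K δ := by
  have : toExponent O (fun i => ((γ + δ) i : ℚ)) =
      toExponent O (fun i => (γ i : ℚ)) + toExponent O (fun i => (δ i : ℚ)) := by
    funext i
    change (((γ + δ) i : ℤ) : ℚ) = (γ i : ℚ) + (δ i : ℚ)
    simp
  rw [monom, this, monom, monom, HahnSeries.single_mul_single, one_mul]

lemma monom_zero {n : ℕ} (O : OrthantOrder n) (K : Type*) [Field K] : monom O K 0 = 1 := by
  have : toExponent O (fun i => ((0 : Fin n → ℤ) i : ℚ)) = 0 := by
    funext i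
    change ((0 : ℤ) : ℚ) = (0 : ℚ)
    simp
  simp only [monom, this]
  rfl

lemma monom_mem {n : ℕ} (O : OrthantOrder n) (K : Type*) [Field K] {γ : Fin n → ℤ}
    (h : 0 ≤ γ) : monom O K γ ∈ powRing O K 1 := by
  refine ⟨_, isNonnegCone_orthant O, fun δ hδ => ?_⟩
  have : δ = toExponent O fun i => (γ i : ℚ) := by
    by_contra hne
    exact hδ (HahnSeries.coeff_single_of_ne hne)
  subst this
  refine ⟨fun i => ?_, fun i => ⟨γ i, ?_⟩⟩
  · change (0 : ℝ) ≤ (((γ i : ℤ) : ℚ) : ℝ)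
    exact_mod_cast h i
  · change ((1 : ℕ) : ℚ) * (γ i : ℚ) = _
    simp

/-- For a ring `A` of series that contains `K_⪯[[X]]`, the ring
`{φ ; ∃ γ ∈ ℤⁿ, X^γ φ ∈ A}`. -/
def invertMonoms {n : ℕ} {O : OrthantOrder n} {K : Type*} [Field K]
    (A : Subring (HahnSeries (Exponent O) K)) (hA : powRing O K 1 ≤ A) :
    Subring (HahnSeries (Exponent O) K) where
  carrier := {φ | ∃ γ : Fin n → ℤ, monom O K γ * φ ∈ A}
  zero_mem' := ⟨0, by simp⟩
  one_mem' := ⟨0, by simp [monom_zero]⟩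
  neg_mem' := by
    rintro φ ⟨γ, h⟩
    exact ⟨γ, by simpa using h⟩
  add_mem' := by
    rintro φ ψ ⟨γ, h⟩ ⟨δ, h'⟩
    have key : ∀ (a b : Fin n → ℤ) (χ : HahnSeries (Exponent O) K), a ≤ b →
        monom O K a * χ ∈ A → monom O K b * χ ∈ A := by
      intro a b χ hab hχ
      have := mul_mem (hA (monom_mem O K (sub_nonneg.mpr hab))) hχ
      rwa [← mul_assoc, ← monom_add, sub_add_cancel] at this
    refine ⟨γ ⊔ δ, ?_⟩
    rw [mul_add]
    exact add_mem (key _ _ _ le_sup_left h) (key _ _ _ le_sup_right h')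
  mul_mem' := by
    rintro φ ψ ⟨γ, h⟩ ⟨δ, h'⟩
    refine ⟨γ + δ, ?_⟩
    have := mul_mem h h'
    rwa [mul_mul_mul_comm, ← monom_add] at this

/-- `K_⪯((X))_k`. For `k = 1` it is `K_⪯((X))`. -/
def laurentRing {n : ℕ} (O : OrthantOrder n) (K : Type*) [Field K] (k : ℕ) :
    Subring (HahnSeries (Exponent O) K) :=
  invertMonoms (powRing O K k) (powRing_one_le O K k)

/-- `𝒮_⪯`. -/
def puiseuxRing {n : ℕ} (O : OrthantOrder n) (K : Type*) [Field K] :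
    Subring (HahnSeries (Exponent O) K) :=
  invertMonoms (unionRing O K) (powRing_le_unionRing O K one_pos)

lemma laurentRing_one_le {n : ℕ} (O : OrthantOrder n) (K : Type*) [Field K] (k : ℕ) :
    laurentRing O K 1 ≤ laurentRing O K k := by
  rintro φ ⟨γ, h⟩
  exact ⟨γ, powRing_one_le O K k h⟩

lemma laurentRing_le_puiseuxRing {n : ℕ} (O : OrthantOrder n) (K : Type*) [Field K] {k : ℕ}
    (hk : 0 < k) : laurentRing O K k ≤ puiseuxRing O K := by
  rintro φ ⟨γ, h⟩
  exact ⟨γ, k, hk, h⟩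

lemma powRing_one_le_puiseuxRing {n : ℕ} (O : OrthantOrder n) (K : Type*) [Field K] :
    powRing O K 1 ≤ puiseuxRing O K :=
  fun φ h => ⟨0, 1, one_pos, by simpa [monom_zero] using h⟩

lemma natExponent_injective {n : ℕ} (O : OrthantOrder n) :
    Function.Injective (natExponent O) := by
  intro a b h
  ext i
  have h' : ((a i : ℕ) : ℚ) = (b i : ℕ) := congrFun h i
  exact_mod_cast h'

lemma natExponent_add {n : ℕ} (O : OrthantOrder n) (a b : Fin n →₀ ℕ) :
    natExponent O (a + b) = natExponent O a + natExponent O b := by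
  funext i
  change (((a + b) i : ℕ) : ℚ) = (a i : ℚ) + (b i : ℚ)
  simp

lemma natExponent_mem {n : ℕ} (O : OrthantOrder n) (m : Fin n →₀ ℕ) :
    realVec (natExponent O m).vec ∈ orthant n ∧ IsKIntegral 1 (natExponent O m).vec := by
  refine ⟨fun i => ?_, fun i => ⟨m i, ?_⟩⟩
  · change (0 : ℝ) ≤ (((m i : ℕ) : ℚ) : ℝ)
    positivity
  · change ((1 : ℕ) : ℚ) * ((m i : ℕ) : ℚ) = _
    simp

/-- The formal power series `φ = ∑ a_m X^m`, as a Hahn series. -/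
noncomputable def seriesFun {n : ℕ} (O : OrthantOrder n) (K : Type*) [Field K]
    (φ : MvPowerSeries (Fin n) K) : HahnSeries (Exponent O) K where
  coeff := Function.extend (natExponent O) (fun m => MvPowerSeries.coeff m φ) 0
  isPWO_support' := by
    refine isPWO_of_subset_cone (isNonnegCone_orthant O) one_pos _ fun γ hγ => ?_
    by_cases h : ∃ m, natExponent O m = γ
    · obtain ⟨m, rfl⟩ := h
      exact natExponent_mem O m
    · exact absurd (Function.extend_apply' _ _ _ h) hγ

lemma seriesFun_coeff {n : ℕ} (O : OrthantOrder n) (K : Type*) [Field K]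
    (φ : MvPowerSeries (Fin n) K) (m : Fin n →₀ ℕ) :
    (seriesFun O K φ).coeff (natExponent O m) = MvPowerSeries.coeff m φ :=
  (natExponent_injective O).extend_apply _ _ _

lemma seriesFun_coeff' {n : ℕ} (O : OrthantOrder n) (K : Type*) [Field K]
    (φ : MvPowerSeries (Fin n) K) {γ : Exponent O} (h : ¬ ∃ m, natExponent O m = γ) :
    (seriesFun O K φ).coeff γ = 0 :=
  Function.extend_apply' _ _ _ h

lemma seriesFun_mem {n : ℕ} (O : OrthantOrder n) (K : Type*) [Field K]
    (φ : MvPowerSeries (Fin n) K) : seriesFun O K φ ∈ powRing O K 1 := by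
  refine ⟨_, isNonnegCone_orthant O, fun γ hγ => ?_⟩
  by_cases h : ∃ m, natExponent O m = γ
  · obtain ⟨m, rfl⟩ := h
    exact natExponent_mem O m
  · exact absurd (seriesFun_coeff' O K φ h) hγ

lemma seriesFun_mul {n : ℕ} (O : OrthantOrder n) (K : Type*) [Field K]
    (φ ψ : MvPowerSeries (Fin n) K) :
    seriesFun O K (φ * ψ) = seriesFun O K φ * seriesFun O K ψ := by
  classical
  have hsupp : ∀ (χ : MvPowerSeries (Fin n) K) (γ : Exponent O),
      γ ∈ (seriesFun O K χ).support → ∃ m, natExponent O m = γ := by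
    intro χ γ hγ
    by_contra h
    exact hγ (seriesFun_coeff' O K χ h)
  ext γ
  rw [HahnSeries.coeff_mul]
  by_cases h : ∃ m, natExponent O m = γ
  · obtain ⟨m, rfl⟩ := h
    rw [seriesFun_coeff, MvPowerSeries.coeff_mul]
    symm
    let e : (Fin n →₀ ℕ) × (Fin n →₀ ℕ) → Exponent O × Exponent O :=
      fun x => (natExponent O x.1, natExponent O x.2)
    have he : Function.Injective e := by
      intro x y hxy
      exact Prod.ext (natExponent_injective O (congrArg Prod.fst hxy))
        (natExponent_injective O (congrArg Prod.snd hxy))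
    have himg : ∑ x ∈ Finset.HasAntidiagonal.antidiagonal m, MvPowerSeries.coeff x.1 φ * MvPowerSeries.coeff x.2 ψ
        = ∑ y ∈ (Finset.HasAntidiagonal.antidiagonal m).image e,
          (seriesFun O K φ).coeff y.1 * (seriesFun O K ψ).coeff y.2 := by
      rw [Finset.sum_image fun x _ y _ hxy => he hxy]
      exact Finset.sum_congr rfl fun x _ => by simp [e, seriesFun_coeff]
    rw [himg]
    refine Finset.sum_subset ?_ ?_
    · rintro ⟨y, z⟩ hyz
      rw [Finset.mem_antidiagonal] at hyz
      obtain ⟨hy, hz, hsum⟩ := hyz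
      obtain ⟨a, rfl⟩ := hsupp φ y hy
      obtain ⟨b, rfl⟩ := hsupp ψ z hz
      refine Finset.mem_image.mpr ⟨(a, b), Finset.HasAntidiagonal.mem_antidiagonal.mpr ?_, rfl⟩
      apply natExponent_injective O
      rw [natExponent_add]
      exact hsum
    · rintro ⟨y, z⟩ hyz hnot
      obtain ⟨⟨a, b⟩, hab, hab'⟩ := Finset.mem_image.mp hyz
      rw [Finset.HasAntidiagonal.mem_antidiagonal] at hab
      by_contra hne
      refine hnot (Finset.mem_antidiagonal.mpr
        ⟨left_ne_zero_of_mul hne, right_ne_zero_of_mul hne, ?_⟩)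
      obtain ⟨rfl, rfl⟩ := Prod.ext_iff.mp hab'
      dsimp only [e] at *
      rw [← hab, natExponent_add]
  · rw [seriesFun_coeff' O K _ h]
    symm
    refine Finset.sum_eq_zero ?_
    rintro ⟨y, z⟩ hyz
    rw [Finset.mem_antidiagonal] at hyz
    obtain ⟨hy, hz, hsum⟩ := hyz
    obtain ⟨a, rfl⟩ := hsupp φ y hy
    obtain ⟨b, rfl⟩ := hsupp ψ z hz
    exact absurd ⟨a + b, by rw [natExponent_add]; exact hsum⟩ h

lemma seriesFun_one {n : ℕ} (O : OrthantOrder n) (K : Type*) [Field K] :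
    seriesFun O K 1 = 1 := by
  classical
  have h0 : natExponent O (0 : Fin n →₀ ℕ) = 0 := by
    funext i
    change ((0 : ℕ) : ℚ) = (0 : ℚ)
    simp
  ext γ
  by_cases h : ∃ m, natExponent O m = γ
  · obtain ⟨m, rfl⟩ := h
    rw [seriesFun_coeff, MvPowerSeries.coeff_one, HahnSeries.coeff_one, ← h0]
    simp [(natExponent_injective O).eq_iff]
  · rw [seriesFun_coeff' O K _ h, HahnSeries.coeff_one, if_neg]
    rintro rfl
    exact h ⟨0, h0⟩

/-- The inclusion `K[[X]] ⊆ K_⪯[[X]]`. -/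
noncomputable def ofSeries {n : ℕ} (O : OrthantOrder n) (K : Type*) [Field K] :
    MvPowerSeries (Fin n) K →+* powRing O K 1 where
  toFun φ := ⟨seriesFun O K φ, seriesFun_mem O K φ⟩
  map_one' := Subtype.ext (seriesFun_one O K)
  map_mul' φ ψ := Subtype.ext (seriesFun_mul O K φ ψ)
  map_zero' := by
    refine Subtype.ext (HahnSeries.ext (funext fun γ => ?_))
    by_cases h : ∃ m, natExponent O m = γ
    · obtain ⟨m, rfl⟩ := h
      simp [seriesFun_coeff]
    · simp [seriesFun_coeff' O K _ h]
  map_add' φ ψ := by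
    refine Subtype.ext (HahnSeries.ext (funext fun γ => ?_))
    by_cases h : ∃ m, natExponent O m = γ
    · obtain ⟨m, rfl⟩ := h
      simp [seriesFun_coeff]
    · simp [seriesFun_coeff' O K _ h]

/-- The set of roots in `𝒮_⪯` of a polynomial over `K_⪯[[X]]`. -/
def rootsIn {n : ℕ} (O : OrthantOrder n) {K : Type*} [Field K]
    (g : Polynomial (powRing O K 1)) : Set (puiseuxRing O K) :=
  {ξ | g.eval₂ (Subring.inclusion (powRing_one_le_puiseuxRing O K)) ξ = 0}

/-- `B` is a `⪯`-branch of `f`: the set of roots in `𝒮_⪯` of an irreducible element of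
`K_⪯[[X]][y]` that divides `f` there. -/
def IsBranch {n : ℕ} (O : OrthantOrder n) {K : Type*} [Field K]
    (f : Polynomial (MvPowerSeries (Fin n) K)) (B : Set (puiseuxRing O K)) : Prop :=
  ∃ g : Polynomial (powRing O K 1),
    Irreducible g ∧ g ∣ f.map (ofSeries O K) ∧ B = rootsIn O g

/-- `f` factorizes in `K_⪯[[X]]_k[y]` as a product of polynomials of degree at most one. -/
def FactorsIn {n : ℕ} (O : OrthantOrder n) {K : Type*} [Field K]
    (f : Polynomial (MvPowerSeries (Fin n) K)) (k : ℕ) : Prop :=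
  ∃ s : Multiset (Polynomial (powRing O K k)), (∀ p ∈ s, p.natDegree ≤ 1) ∧
    (f.map (ofSeries O K)).map (Subring.inclusion (powRing_one_le O K k)) = s.prod

/-- The series obtained from `φ` by multiplying the coefficient of `X^γ` by `c γ`. -/
def twist {n : ℕ} {O : OrthantOrder n} {K : Type*} [Field K] (c : Exponent O → K)
    (φ : HahnSeries (Exponent O) K) : HahnSeries (Exponent O) K where
  coeff γ := c γ * φ.coeff γ
  isPWO_support' := φ.isPWO_support.mono fun _ h => right_ne_zero_of_mul h

/-- The map `τ_{η,μ}` of `K_⪯((X))_k` to itself that substitutes `η^{μ_i} x_i^{1/k}` for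
`x_i^{1/k}`: as `X^γ = ∏ (x_i^{1/k})^{k γ_i}`, it multiplies the coefficient of `X^γ` by
`∏ (η^{μ_i})^{k γ_i}`, where `k γ_i` is an integer. -/
def tau {n : ℕ} {O : OrthantOrder n} {K : Type*} [Field K] {k : ℕ} (η : K) (μ : Fin n → Fin k)
    (φ : laurentRing O K k) : laurentRing O K k :=
  ⟨twist (fun γ => ∏ i, (η ^ (μ i : ℕ)) ^ ((k : ℚ) * γ.vec i).num) φ.1, by
    obtain ⟨φ, δ, σ, hσ, h⟩ := φ
    refine ⟨δ, σ, hσ, fun γ hγ => h γ ?_⟩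
    simp only [monom, HahnSeries.coeff_single_mul, one_mul] at hγ ⊢
    exact right_ne_zero_of_mul hγ⟩

/-- `B(ξ) = {τ_{η,μ}(ξ) ; μ ∈ {0, …, k-1}ⁿ}`, as a subset of `𝒮_⪯`. -/
def tauOrbit {n : ℕ} {O : OrthantOrder n} {K : Type*} [Field K] {k : ℕ} (hk : 0 < k) (η : K)
    (ξ : laurentRing O K k) : Set (puiseuxRing O K) :=
  {β | ∃ μ : Fin n → Fin k,
    β = Subring.inclusion (laurentRing_le_puiseuxRing O K hk) (tau η μ ξ)}

/-- The orbit of `ξ`, as a subset of `𝒮_⪯`, under the group of automorphisms of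
`K_⪯((X))_k` that fix every element of `K_⪯((X))`. -/
def galoisOrbit {n : ℕ} {O : OrthantOrder n} {K : Type*} [Field K] {k : ℕ} (hk : 0 < k)
    (ξ : laurentRing O K k) : Set (puiseuxRing O K) :=
  {β | ∃ s : laurentRing O K k ≃+* laurentRing O K k,
    (∀ a : laurentRing O K 1, s (Subring.inclusion (laurentRing_one_le O K k) a) =
      Subring.inclusion (laurentRing_one_le O K k) a) ∧
    β = Subring.inclusion (laurentRing_le_puiseuxRing O K hk) (s ξ)}

end ConeSeries

/-! Let `ζ` be `ξ` seen in `K_⪯((X))_k`, and let `P = ∏ (y - β)` run over its distinct conjugates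
`τ_{η,μ}(ζ)`. The maps `τ_{η,μ}` permute these conjugates, so they fix the coefficients of `P`; a
series fixed by all of them has integral exponents, hence `P` lies over `K_⪯((X))`. Conversely, a
polynomial over `K_⪯((X))` that vanishes at `ζ` vanishes at every conjugate, so the monic `P`
divides it (`conjPoly_dvd`). This already gives the Galois orbit: an automorphism over `K_⪯((X))`
sends `ζ` to a root of `P`.

For branches one needs a multiple `g = uP` over `K_⪯[[X]]` that divides, over `K_⪯[[X]]`, every
polynomial vanishing at `ξ`. Such a `g` generates the prime ideal of these polynomials, so it is
prime, and every irreducible polynomial with root `ξ` is associated to it. If `f` is monic, `ξ` lies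
in `K_⪯[[X]]_k` and `g = P` works, by monic division (`exists_generator_of_mem_powRing`). For a
vector space order, `K_⪯[[X]]` consists of the elements of `K_⪯((X))` with non-negative exponents,
by Gordan's lemma; a monomial multiple of `P` is primitive, and Gauss's lemma applies
(`exists_generator_of_isVectorOrder`).

That `ξ` lies in `K_⪯((X))_k` follows from a relation `aξ = b` given by a linear factor of `f`
(`FactorsIn.mem_laurentRing`). -/

namespace ConeSeries

/-! ### Gauss's lemma for Hahn series -/

section HahnGauss

variable {Γ R : Type*} [AddCommGroup Γ] [LinearOrder Γ] [IsOrderedAddMonoid Γ]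

/-- On series with non-negative exponents, taking the constant coefficient is multiplicative. -/
lemma coeff_zero_mul_of_nonneg [Semiring R] {φ ψ : HahnSeries Γ R}
    (hφ : ∀ γ, φ.coeff γ ≠ 0 → 0 ≤ γ) (hψ : ∀ γ, ψ.coeff γ ≠ 0 → 0 ≤ γ) :
    (φ * ψ).coeff 0 = φ.coeff 0 * ψ.coeff 0 := by
  rw [HahnSeries.coeff_mul]
  refine Finset.sum_eq_single (0, 0) ?_ ?_
  · rintro ⟨a, b⟩ hab hne
    rw [Finset.mem_antidiagonal] at hab
    obtain ⟨ha, hb, h0⟩ := hab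
    have ha' := hφ a ha
    have hb' := hψ b hb
    obtain ⟨rfl, rfl⟩ := (add_eq_zero_iff_of_nonneg ha' hb').mp h0
    exact absurd rfl hne
  · intro h
    by_contra hne
    exact h (Finset.mem_antidiagonal.mpr
      ⟨left_ne_zero_of_mul hne, right_ne_zero_of_mul hne, add_zero 0⟩)

/-- **Gauss's lemma** for the natural valuation on Hahn series: a product of primitive polynomials
is primitive. -/
lemma exists_coeff_mul_coeff_zero_ne_zero [CommRing R] [IsDomain R]
    {g q : Polynomial (HahnSeries Γ R)}
    (hg : ∀ i γ, (g.coeff i).coeff γ ≠ 0 → 0 ≤ γ) (hq : ∀ i γ, (q.coeff i).coeff γ ≠ 0 → 0 ≤ γ)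
    (hg0 : ∃ i, (g.coeff i).coeff 0 ≠ 0) (hq0 : ∃ i, (q.coeff i).coeff 0 ≠ 0) :
    ∃ i, ((g * q).coeff i).coeff 0 ≠ 0 := by
  -- Reduction to constant coefficients. Its target is power series in `y`, a domain in which no
  -- finiteness has to be checked.
  let ρ : Polynomial (HahnSeries Γ R) → PowerSeries R := fun p =>
    PowerSeries.mk fun i => (p.coeff i).coeff 0
  have hρ : ρ (g * q) = ρ g * ρ q := by
    ext i
    simp only [ρ, PowerSeries.coeff_mk, PowerSeries.coeff_mul, Polynomial.coeff_mul,
      HahnSeries.coeff_sum]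
    exact Finset.sum_congr rfl fun x _ => coeff_zero_mul_of_nonneg (hg x.1) (hq x.2)
  have hne : ∀ p : Polynomial (HahnSeries Γ R), ρ p ≠ 0 ↔ ∃ i, (p.coeff i).coeff 0 ≠ 0 := by
    intro p
    simp [ρ, PowerSeries.ext_iff]
  rw [← hne, hρ]
  exact mul_ne_zero ((hne g).mpr hg0) ((hne q).mpr hq0)

/-- A quotient of a polynomial with non-negative exponents by a primitive polynomial has
non-negative exponents. -/
lemma nonneg_of_mul_nonneg [CommRing R] [IsDomain R] {g q : Polynomial (HahnSeries Γ R)}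
    (hg : ∀ i γ, (g.coeff i).coeff γ ≠ 0 → 0 ≤ γ) (hg0 : ∃ i, (g.coeff i).coeff 0 ≠ 0)
    (h : ∀ i γ, ((g * q).coeff i).coeff γ ≠ 0 → 0 ≤ γ) :
    ∀ i γ, (q.coeff i).coeff γ ≠ 0 → 0 ≤ γ := by
  intro i γ hγ
  have hi : i ∈ q.support := by
    rw [Polynomial.mem_support_iff]
    rintro h0
    simp [h0] at hγ
  -- Scaling by the inverse of the monomial of least order `m` makes `q` primitive; Gauss's lemma
  -- then gives `g * q` a nonzero coefficient at `m`, so `0 ≤ m ≤ γ`. Only the support is searched,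
  -- because the zero series has order `0` by convention.
  obtain ⟨j, hj, hmin⟩ := q.support.exists_min_image (fun i => (q.coeff i).order) ⟨i, hi⟩
  set m := (q.coeff j).order
  have hq' : ∀ (p : Polynomial (HahnSeries Γ R)) i γ,
      ((Polynomial.C (HahnSeries.single (-m) (1 : R)) * p).coeff i).coeff γ
        = (p.coeff i).coeff (γ + m) := by
    intro p i γ
    rw [Polynomial.coeff_C_mul, HahnSeries.coeff_single_mul, one_mul, sub_neg_eq_add]
  obtain ⟨l, hl⟩ := exists_coeff_mul_coeff_zero_ne_zero
    (q := Polynomial.C (HahnSeries.single (-m) (1 : R)) * q) hg (fun i γ hγ => by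
      rw [hq'] at hγ
      have hi : i ∈ q.support := by
        rw [Polynomial.mem_support_iff]
        rintro h0
        simp [h0] at hγ
      have := (hmin i hi).trans (HahnSeries.order_le_of_coeff_ne_zero hγ)
      simpa using this) hg0 ⟨j, by
      rw [hq', zero_add]
      exact HahnSeries.coeff_order_eq_zero.not.mpr (Polynomial.mem_support_iff.mp hj)⟩
  rw [mul_left_comm, hq', zero_add] at hl
  exact (h l m hl).trans ((hmin i hi).trans (HahnSeries.order_le_of_coeff_ne_zero hγ))

end HahnGauss

/-! ### Multiplying coefficients by a function of the exponent -/

section Twist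

variable {n : ℕ} {O : OrthantOrder n} {K : Type*} [Field K]

@[simp] lemma twist_coeff (c : Exponent O → K) (φ : HahnSeries (Exponent O) K) (γ : Exponent O) :
    (twist c φ).coeff γ = c γ * φ.coeff γ := rfl

/-- Three factors serve two uses: characters (`c = d = e`), multiplicative only on the exponents
that occur, and projections to a set of exponents (`d = 1`, `c = e`). -/
lemma twist_mul {c d e : Exponent O → K} {φ ψ : HahnSeries (Exponent O) K}
    (h : ∀ a b, φ.coeff a ≠ 0 → ψ.coeff b ≠ 0 → c (a + b) = d a * e b) :
    twist c (φ * ψ) = twist d φ * twist e ψ := by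
  have hd : (twist d φ).support ⊆ φ.support := fun γ hγ =>
    right_ne_zero_of_mul (show d γ * φ.coeff γ ≠ 0 from hγ)
  ext γ
  -- Factors may vanish and shrink supports, so both sums are first brought to the pairs from the
  -- supports of `φ` and `twist e ψ`.
  rw [twist_coeff, HahnSeries.coeff_mul, Finset.mul_sum,
    HahnSeries.coeff_mul_left' φ.isPWO_support hd,
    ← Finset.sum_subset (s₁ := Finset.antidiagonal φ.isPWO_support
      (twist e ψ).isPWO_support γ) (s₂ := Finset.antidiagonal φ.isPWO_support ψ.isPWO_support γ)]
  · refine Finset.sum_congr rfl ?_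
    rintro ⟨a, b⟩ hab
    rw [Finset.mem_antidiagonal] at hab
    obtain ⟨ha, hb, rfl⟩ := hab
    rw [h a b ha (right_ne_zero_of_mul hb)]
    simp only [twist_coeff]
    ring
  · rintro ⟨a, b⟩ hab
    rw [Finset.mem_antidiagonal] at hab ⊢
    exact ⟨hab.1, right_ne_zero_of_mul hab.2.1, hab.2.2⟩
  · rintro ⟨a, b⟩ hab hnot
    rw [Finset.mem_antidiagonal] at hab hnot
    obtain ⟨ha, hb, rfl⟩ := hab
    have : e b * ψ.coeff b = 0 := by
      by_contra hne
      exact hnot ⟨ha, hne, rfl⟩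
    rw [h a b ha hb]
    linear_combination (d a * φ.coeff a) * this

end Twist

/-! ### Membership in the rings of series -/

section Membership

variable {n : ℕ} {O : OrthantOrder n} {K : Type*} [Field K]

lemma vec_add (γ δ : Exponent O) : (γ + δ).vec = γ.vec + δ.vec := rfl

lemma vec_sub (γ δ : Exponent O) : (γ - δ).vec = γ.vec - δ.vec := rfl

lemma vec_zero : (0 : Exponent O).vec = 0 := rfl

/-- The integral exponent with the given coordinates. -/
def intExponent (O : OrthantOrder n) (γ : Fin n → ℤ) : Exponent O :=
  toExponent O fun i => (γ i : ℚ)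

lemma isKIntegral_intExponent (k : ℕ) (γ : Fin n → ℤ) : IsKIntegral k (intExponent O γ).vec :=
  fun i => ⟨k * γ i, by simp [intExponent, Exponent.vec, toExponent]⟩

lemma IsKIntegral.neg {k : ℕ} {γ : Fin n → ℚ} (h : IsKIntegral k γ) : IsKIntegral k (-γ) := by
  intro i
  obtain ⟨a, ha⟩ := h i
  exact ⟨-a, by simp [ha]⟩

lemma IsKIntegral.sub {k : ℕ} {γ δ : Fin n → ℚ} (h : IsKIntegral k γ) (h' : IsKIntegral k δ) :
    IsKIntegral k (γ - δ) := by
  rw [sub_eq_add_neg]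
  exact h.add h'.neg

lemma monom_mul_coeff (γ : Fin n → ℤ) (φ : HahnSeries (Exponent O) K) (δ : Exponent O) :
    (monom O K γ * φ).coeff δ = φ.coeff (δ - intExponent O γ) := by
  rw [monom, HahnSeries.coeff_single_mul, one_mul]
  rfl

/-- Integral translations preserve `(1/k)ℤⁿ`, so the cone condition, which does not involve `k`,
separates from the condition on denominators. Changing `k` then concerns denominators only. -/
lemma mem_laurentRing_iff {k : ℕ} {φ : HahnSeries (Exponent O) K} :
    φ ∈ laurentRing O K k ↔
      (∃ (γ : Fin n → ℤ) (σ : _), IsNonnegCone O σ ∧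
        ∀ δ, φ.coeff δ ≠ 0 → realVec (intExponent O γ + δ).vec ∈ σ) ∧
      ∀ δ, φ.coeff δ ≠ 0 → IsKIntegral k δ.vec := by
  constructor
  · rintro ⟨γ, σ, hσ, h⟩
    have key : ∀ δ, φ.coeff δ ≠ 0 → (monom O K γ * φ).coeff (intExponent O γ + δ) ≠ 0 := by
      intro δ hδ
      rwa [monom_mul_coeff, add_sub_cancel_left]
    refine ⟨⟨γ, σ, hσ, fun δ hδ => (h _ (key δ hδ)).1⟩, fun δ hδ => ?_⟩
    have := (h _ (key δ hδ)).2.sub (isKIntegral_intExponent (O := O) k γ)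
    rwa [← vec_sub, add_sub_cancel_left] at this
  · rintro ⟨⟨γ, σ, hσ, h⟩, h'⟩
    refine ⟨γ, σ, hσ, fun δ hδ => ?_⟩
    rw [monom_mul_coeff] at hδ
    have h1 := h _ hδ
    rw [add_sub_cancel] at h1
    have h2 := (isKIntegral_intExponent (O := O) k γ).add (h' _ hδ)
    rw [← vec_add, add_sub_cancel] at h2
    exact ⟨h1, h2⟩

/-- A quotient of two series with exponents in `(1/k)ℤⁿ` has its exponents there. -/
lemma isKIntegral_of_mul {k : ℕ} {φ ψ χ : HahnSeries (Exponent O) K} (hφ0 : φ ≠ 0)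
    (hφ : ∀ δ, φ.coeff δ ≠ 0 → IsKIntegral k δ.vec)
    (hχ : ∀ δ, χ.coeff δ ≠ 0 → IsKIntegral k δ.vec) (h : φ * ψ = χ) :
    ∀ δ, ψ.coeff δ ≠ 0 → IsKIntegral k δ.vec := by
  classical
  -- Twisting by this indicator projects to the exponents in the group `(1/k)ℤⁿ`. The projection
  -- commutes with multiplication by `φ` and fixes `χ`, so cancelling `φ` shows that it fixes `ψ`.
  let c : Exponent O → K := fun δ => if IsKIntegral k δ.vec then 1 else 0
  have hc : ∀ ω : HahnSeries (Exponent O) K,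
      twist c ω = ω ↔ ∀ δ, ω.coeff δ ≠ 0 → IsKIntegral k δ.vec := by
    intro ω
    constructor
    · intro hω δ hδ
      by_contra hn
      rw [← hω] at hδ
      simp [c, hn] at hδ
    · intro hω
      ext δ
      by_cases hδ : ω.coeff δ = 0
      · simp [hδ]
      · simp [c, hω δ hδ]
  have h1 : twist c (φ * ψ) = φ * twist c ψ := by
    have h2 := twist_mul (c := c) (d := 1) (e := c) (φ := φ) (ψ := ψ) fun a b ha _ => by
      have hab : IsKIntegral k (a + b).vec ↔ IsKIntegral k b.vec := by
        constructor
        · intro hab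
          have := hab.sub (hφ a ha)
          rwa [← vec_sub, add_sub_cancel_left] at this
        · exact fun hb => (hφ a ha).add hb
      simp [c, hab]
    rw [h2]
    congr 1
    ext δ
    simp
  rw [← hc]
  rw [h, (hc χ).mpr hχ, ← h] at h1
  exact (mul_left_cancel₀ hφ0 h1).symm

lemma mem_powRing_one_of_mem {k : ℕ} {φ : HahnSeries (Exponent O) K}
    (hφ : φ ∈ powRing O K k) (h : ∀ δ, φ.coeff δ ≠ 0 → IsKIntegral 1 δ.vec) :
    φ ∈ powRing O K 1 := by
  obtain ⟨σ, hσ, hs⟩ := hφ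
  exact ⟨σ, hσ, fun δ hδ => ⟨(hs δ hδ).1, h δ hδ⟩⟩

lemma powRing_le_laurentRing (k : ℕ) : powRing O K k ≤ laurentRing O K k :=
  fun φ h => ⟨0, by simpa [monom_zero] using h⟩

lemma ofSeries_injective : Function.Injective (ofSeries O K) := by
  intro φ ψ h
  ext m
  rw [← seriesFun_coeff O K φ, ← seriesFun_coeff O K ψ]
  exact congrArg (fun χ => HahnSeries.coeff χ _) (congrArg Subtype.val h)

end Membership

/-! ### Gordan's lemma -/

section Cones

/-- Dickson's lemma: the minimal values of `e` form an antichain, hence a finite set, and one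
preimage of each suffices. -/
lemma exists_finite_subset_forall_exists_le {α β : Type*} [PartialOrder α] [WellQuasiOrderedLE α]
    (S : Set β) (e : S → α) :
    ∃ F : Set S, F.Finite ∧ ∀ x : S, ∃ y ∈ F, e y ≤ e x := by
  have hfin : {a | Minimal (· ∈ Set.range e) a}.Finite :=
    WellQuasiOrderedLE.finite_of_isAntichain (setOfPred_minimal_antichain _)
  choose g hg using fun a : {a | Minimal (· ∈ Set.range e) a} => a.2.prop
  have : Finite {a | Minimal (· ∈ Set.range e) a} := hfin
  refine ⟨Set.range g, Set.finite_range g, fun x => ?_⟩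
  obtain ⟨a, hax, ha⟩ := exists_minimal_le_of_wellFoundedLT (· ∈ Set.range e) (e x) ⟨x, rfl⟩
  exact ⟨g ⟨a, ha⟩, ⟨_, rfl⟩, (hg ⟨a, ha⟩).trans_le hax⟩

lemma exists_common_denominator {s n : ℕ} (u : Fin s → Fin n → ℚ) :
    ∃ D : ℕ, 0 < D ∧ ∀ i j, ∃ m : ℤ, (D : ℚ) * u i j = m := by
  refine ⟨∏ i, ∏ j, (u i j).den,
    Finset.prod_pos fun i _ => Finset.prod_pos fun j _ => (u i j).den_pos, fun i j => ?_⟩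
  obtain ⟨e, he⟩ : (u i j).den ∣ ∏ i, ∏ j, (u i j).den :=
    (Finset.dvd_prod_of_mem (fun j => (u i j).den) (Finset.mem_univ j)).trans
      (Finset.dvd_prod_of_mem (fun i => ∏ j, (u i j).den) (Finset.mem_univ i))
  refine ⟨e * (u i j).num, ?_⟩
  rw [he]
  push_cast
  rw [mul_comm ((u i j).den : ℚ), mul_assoc, Rat.den_mul_eq_num]

/-- **Gordan's lemma**, relative form: a set of points of `(1/k)ℤⁿ` in a translate of a rational
cone `σ` is contained in `F + σ` for a finite subset `F`. -/
lemma IsRationalCone.exists_finite_subset {n : ℕ} {σ : Set (Fin n → ℝ)} (hσ : IsRationalCone σ)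
    {k : ℕ} (hk : 0 < k) {v : Fin n → ℚ} (hv : IsKIntegral k v) (S : Set (Fin n → ℚ))
    (hS : ∀ x ∈ S, realVec (v + x) ∈ σ ∧ IsKIntegral k x) :
    ∃ F : Set S, F.Finite ∧ ∀ x : S, ∃ y ∈ F, realVec (x.1 - y.1) ∈ σ := by
  obtain ⟨s, u, rfl⟩ := hσ
  obtain ⟨D, hD, hDu⟩ := exists_common_denominator u
  choose w hw using hDu
  choose c hc hcx using fun x : S => (hS x.1 x.2).1
  choose p hp using fun x : S => hv.add (hS x.1 x.2).2
  let a : S → Fin s → ℕ := fun x i => ⌊c x i⌋₊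
  have ha : ∀ x i, 0 ≤ c x i - a x i ∧ c x i - a x i ≤ 1 := fun x i =>
    ⟨sub_nonneg.mpr (Nat.floor_le (hc x i)), by
      have := (Nat.lt_floor_add_one (c x i)).le
      simp only [a]
      linarith⟩
  -- the remainders, scaled to be integral
  let m : S → Fin n → ℤ := fun x j => D * p x j - k * ∑ i, (a x i : ℤ) * w i j
  have hm : ∀ x j, (m x j : ℚ) = k * D * ((v + x.1) j - ∑ i, (a x i : ℚ) * u i j) := by
    intro x j
    simp only [m]
    push_cast
    rw [← hp]
    simp only [← hw]
    rw [mul_sub, Finset.mul_sum, Finset.mul_sum]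
    congr 1
    · ring
    · exact Finset.sum_congr rfl fun i _ => by ring
  have hvx : ∀ (x : S) j, (((v + x.1) j : ℚ) : ℝ) = ∑ i, c x i * (u i j : ℝ) := by
    intro x j
    have := congrFun (hcx x) j
    simpa [realVec] using this
  have hmR : ∀ x j, (m x j : ℝ) = k * D * ∑ i, (c x i - a x i) * (u i j : ℝ) := by
    intro x j
    have h1 : (m x j : ℝ) = k * D * ((((v + x.1) j : ℚ) : ℝ) - ∑ i, (a x i : ℝ) * u i j) := by
      exact_mod_cast congrArg (fun q : ℚ => (q : ℝ)) (hm x j)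
    rw [h1, hvx]
    simp only [sub_mul, Finset.sum_sub_distrib]
  let N : Fin n → ℤ := fun j => ⌈(k * D * ∑ i, |(u i j : ℝ)| : ℝ)⌉
  have hmN : ∀ x j, |m x j| ≤ N j := by
    intro x j
    have h1 : |(m x j : ℝ)| ≤ k * D * ∑ i, |(u i j : ℝ)| := by
      rw [hmR, abs_mul, abs_of_nonneg (by positivity : (0 : ℝ) ≤ k * D)]
      refine mul_le_mul_of_nonneg_left ?_ (by positivity)
      refine (Finset.abs_sum_le_sum_abs _ _).trans (Finset.sum_le_sum fun i _ => ?_)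
      rw [abs_mul, abs_of_nonneg (ha x i).1]
      exact mul_le_of_le_one_left (abs_nonneg _) (ha x i).2
    have h2 : |(m x j : ℝ)| ≤ (N j : ℝ) := h1.trans (Int.le_ceil _)
    exact_mod_cast h2
  -- The bounded remainder enters as both `N + m` and `N - m`, so that `e y ≤ e x` forces equal
  -- remainders. Then `x - y` is the combination of the generators with coefficients `a x i - a y i
  -- ≥ 0`.
  let e : S → (Fin s → ℕ) × (Fin n → ℕ) × (Fin n → ℕ) := fun x =>
    (a x, (fun j => (N j + m x j).toNat), fun j => (N j - m x j).toNat)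
  obtain ⟨F, hF, hFS⟩ := exists_finite_subset_forall_exists_le S e
  refine ⟨F, hF, fun x => ?_⟩
  obtain ⟨y, hy, hle⟩ := hFS x
  obtain ⟨hle₁, hle₂, hle₃⟩ := hle
  have hmxy : ∀ j, m x j = m y j := by
    intro j
    have h₂ := hle₂ j
    have h₃ := hle₃ j
    have hx := abs_le.mp (hmN x j)
    have hy := abs_le.mp (hmN y j)
    simp only [e] at h₂ h₃
    omega
  refine ⟨y, hy, fun i => (a x i : ℝ) - a y i, fun i => sub_nonneg.mpr (by
    exact_mod_cast hle₁ i), ?_⟩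
  funext j
  have h1 := hm x j
  rw [hmxy, hm y j] at h1
  have hkD : (k * D : ℚ) ≠ 0 := by positivity
  have h2 := mul_left_cancel₀ hkD h1
  have h3 : (x.1 - y.1) j = ∑ i, ((a x i : ℚ) - a y i) * u i j := by
    simp only [sub_mul, Finset.sum_sub_distrib]
    simp only [Pi.add_apply, Pi.sub_apply] at h2 ⊢
    linarith
  simp only [realVec, h3, Finset.sum_apply, Pi.smul_apply, smul_eq_mul]
  push_cast
  rfl

end Cones

/-! ### Vector space orders and non-negative exponents -/

section VectorOrder

variable {n : ℕ} {O : OrthantOrder n} {K : Type*} [Field K]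

lemma OrthantOrder.le_zero_add {u v : Fin n → ℝ} (hu : O.le 0 u) (hv : O.le 0 v) :
    O.le 0 (u + v) := by
  have := O.add_le_add _ _ v hu
  rw [zero_add] at this
  exact O.le_trans _ _ _ hv this

lemma OrthantOrder.le_zero_sum {ι : Type*} (s : Finset ι) {u : ι → Fin n → ℝ}
    (hu : ∀ i ∈ s, O.le 0 (u i)) : O.le 0 (∑ i ∈ s, u i) :=
  Finset.sum_induction u (fun v => O.le 0 v) (fun _ _ => O.le_zero_add) (O.le_refl 0) hu

/-- For a vector space order, the cone over finitely many non-negative vectors is non-negative. -/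
lemma OrthantOrder.IsVectorOrder.isNonnegCone (hO : O.IsVectorOrder) {s : ℕ}
    {u : Fin s → Fin n → ℚ} (hu : ∀ i, O.le 0 (realVec (u i))) :
    IsNonnegCone O {v | ∃ c : Fin s → ℝ, (∀ i, 0 ≤ c i) ∧ v = ∑ i, c i • realVec (u i)} := by
  refine ⟨⟨s, u, rfl⟩, ?_⟩
  rintro v ⟨c, hc, rfl⟩
  refine O.le_zero_sum _ fun i _ => ?_
  rcases (hc i).eq_or_lt with h | h
  · rw [← h, zero_smul]
    exact O.le_refl 0
  · exact hO _ _ h (hu i)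

lemma IsRationalCone.mem_of_generator {s : ℕ} (u : Fin s → Fin n → ℚ) (i : Fin s) :
    realVec (u i) ∈ {v | ∃ c : Fin s → ℝ, (∀ i, 0 ≤ c i) ∧ v = ∑ i, c i • realVec (u i)} := by
  refine ⟨Pi.single i 1, fun l => ?_, ?_⟩
  · by_cases hl : l = i
    · subst hl; simp
    · simp [hl]
  · rw [Finset.sum_eq_single i]
    · simp
    · intro l _ hl
      simp [hl]
    · simp

/-- For a vector space order, `K_⪯[[X]]_k` is the valuation ring of `K_⪯((X))_k`. -/
lemma OrthantOrder.IsVectorOrder.mem_powRing (hO : O.IsVectorOrder) {k : ℕ} (hk : 0 < k)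
    {φ : HahnSeries (Exponent O) K} (hφ : φ ∈ laurentRing O K k)
    (hpos : ∀ δ, φ.coeff δ ≠ 0 → 0 ≤ δ) : φ ∈ powRing O K k := by
  obtain ⟨⟨γ, σ, hσ, h⟩, hint⟩ := mem_laurentRing_iff.mp hφ
  obtain ⟨F, hF, hFS⟩ := hσ.1.exists_finite_subset hk (isKIntegral_intExponent (O := O) k γ)
    {x | φ.coeff (toExponent O x) ≠ 0} fun x hx => ⟨h _ hx, hint _ hx⟩
  have := hF.to_subtype
  obtain ⟨t, ⟨g⟩⟩ := Finite.exists_equiv_fin F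
  -- The finite set `F` consists of exponents of `φ`, which are non-negative; compatibility with
  -- scalars makes the cone over them non-negative. Together with `σ` it captures the whole support.
  have hτ := hO.isNonnegCone (O := O) (u := fun i => (g.symm i).1.1) fun i => by
    have := hpos _ (g.symm i).1.2
    rw [← realVec_zero]
    exact this
  obtain ⟨ρ, hρ, hσρ, hτρ⟩ := hσ.exists_sup hτ
  refine ⟨ρ, hρ, fun δ hδ => ⟨?_, hint δ hδ⟩⟩
  obtain ⟨y, hy, hyδ⟩ := hFS ⟨δ.vec, hδ⟩
  have h1 := hτρ (IsRationalCone.mem_of_generator (fun i => (g.symm i).1.1) (g ⟨y, hy⟩))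
  have h2 := hρ.1.add_mem (hσρ hyδ) h1
  simp only [Equiv.symm_apply_apply] at h2
  rwa [← realVec_add, sub_add_cancel] at h2

end VectorOrder

open Polynomial

/-! ### The maps `τ_{η,μ}` and the polynomial of the conjugates -/

section Tau

variable {n : ℕ} {O : OrthantOrder n} {K : Type*} [Field K] {k : ℕ}

/-- The factor by which `τ_{η,μ}` multiplies the coefficient of `X^γ`. -/
def tauFactor (η : K) (μ : Fin n → Fin k) (γ : Exponent O) : K :=
  ∏ i, (η ^ (μ i : ℕ)) ^ ((k : ℚ) * γ.vec i).num

lemma coe_tau (η : K) (μ : Fin n → Fin k) (φ : laurentRing O K k) :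
    (tau η μ φ : HahnSeries (Exponent O) K) = twist (tauFactor η μ) φ.1 := rfl

lemma tauFactor_ne_zero {η : K} (hη : η ≠ 0) (μ : Fin n → Fin k) (γ : Exponent O) :
    tauFactor η μ γ ≠ 0 :=
  Finset.prod_ne_zero_iff.mpr fun _ _ => zpow_ne_zero _ (pow_ne_zero _ hη)

/-- The numerator of `k γ_i` equals `k γ_i` only for exponents in `(1/k)ℤⁿ`, whence the hypotheses.
-/
lemma tauFactor_add {η : K} (hη : η ≠ 0) (μ : Fin n → Fin k) {γ δ : Exponent O}
    (hγ : IsKIntegral k γ.vec) (hδ : IsKIntegral k δ.vec) :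
    tauFactor η μ (γ + δ) = tauFactor η μ γ * tauFactor η μ δ := by
  simp only [tauFactor, ← Finset.prod_mul_distrib]
  refine Finset.prod_congr rfl fun i _ => ?_
  obtain ⟨a, ha⟩ := hγ i
  obtain ⟨b, hb⟩ := hδ i
  rw [← zpow_add₀ (pow_ne_zero _ hη), vec_add, Pi.add_apply, mul_add, ha, hb]
  congr 1
  rw [← Int.cast_add]
  simp only [Rat.num_intCast]

lemma tauFactor_zero (η : K) (μ : Fin n → Fin k) : tauFactor η μ (0 : Exponent O) = 1 := by
  simp [tauFactor, vec_zero]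

lemma tauFactor_eq_one {η : K} (hη : η ^ k = 1) (μ : Fin n → Fin k) {γ : Exponent O}
    (hγ : IsKIntegral 1 γ.vec) : tauFactor η μ γ = 1 := by
  refine Finset.prod_eq_one fun i _ => ?_
  obtain ⟨a, ha⟩ := hγ i
  have h : (k : ℚ) * γ.vec i = ((k * a : ℤ) : ℚ) := by
    push_cast
    rw [← ha]
    simp
  rw [h, Rat.num_intCast, zpow_mul, zpow_natCast, ← pow_mul, mul_comm, pow_mul, hη, one_pow,
    one_zpow]

lemma tauFactor_add_index {η : K} (hη : η ^ k = 1) (μ ν : Fin n → Fin k) (γ : Exponent O) :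
    tauFactor η (μ + ν) γ = tauFactor η μ γ * tauFactor η ν γ := by
  simp only [tauFactor, ← Finset.prod_mul_distrib]
  refine Finset.prod_congr rfl fun i _ => ?_
  rw [← mul_zpow, ← pow_add, Pi.add_apply, Fin.val_add, ← pow_eq_pow_mod _ hη]

/-- The exponents on which all `τ_{η,μ}` act trivially are those in `ℤⁿ`. -/
lemma isKIntegral_one_of_tauFactor_eq_one {η : K} (hk : 0 < k) (hη : IsPrimitiveRoot η k)
    {γ : Exponent O} (hγ : IsKIntegral k γ.vec)
    (h : ∀ μ : Fin n → Fin k, tauFactor η μ γ = 1) : IsKIntegral 1 γ.vec := by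
  classical
  intro i
  obtain ⟨a, ha⟩ := hγ i
  -- Twisting the single variable `x_i` by `η` isolates the coordinate `i`; `1 % k` also covers `k =
  -- 1`.
  have hi := h fun j => if j = i then ⟨1 % k, Nat.mod_lt _ hk⟩ else ⟨0, hk⟩
  rw [tauFactor, Finset.prod_eq_single i (fun j _ hj => by simp [hj]) (by simp)] at hi
  simp only [if_true, ← pow_eq_pow_mod _ hη.pow_eq_one, pow_one, ha, Rat.num_intCast] at hi
  obtain ⟨b, rfl⟩ := (hη.zpow_eq_one_iff_dvd a).mp hi
  refine ⟨b, ?_⟩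
  have hkQ : (k : ℚ) ≠ 0 := by exact_mod_cast hk.ne'
  refine mul_left_cancel₀ hkQ ?_
  push_cast at ha
  rw [Nat.cast_one, one_mul, ha]

lemma isKIntegral_of_mem {φ : HahnSeries (Exponent O) K} (hφ : φ ∈ laurentRing O K k) :
    ∀ δ, φ.coeff δ ≠ 0 → IsKIntegral k δ.vec :=
  (mem_laurentRing_iff.mp hφ).2

/-- `τ_{η,μ}` as a ring homomorphism. -/
noncomputable def tauHom {η : K} (hη : η ≠ 0) (μ : Fin n → Fin k) :
    laurentRing O K k →+* laurentRing O K k where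
  toFun := tau η μ
  map_one' := by
    refine Subtype.ext ?_
    rw [coe_tau]
    ext γ
    by_cases hγ : γ = 0
    · simp [hγ, tauFactor_zero]
    · simp [HahnSeries.coeff_one, hγ]
  map_mul' φ ψ := Subtype.ext <| twist_mul fun a b ha hb =>
    tauFactor_add hη μ (isKIntegral_of_mem φ.2 a ha) (isKIntegral_of_mem ψ.2 b hb)
  map_zero' := by
    refine Subtype.ext ?_
    rw [coe_tau]
    ext γ
    simp
  map_add' φ ψ := by
    refine Subtype.ext ?_
    change twist _ _ = twist _ _ + twist _ _
    ext γ
    simp [mul_add]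

@[simp] lemma tauHom_apply {η : K} (hη : η ≠ 0) (μ : Fin n → Fin k) (φ : laurentRing O K k) :
    tauHom hη μ φ = tau η μ φ := rfl

lemma tau_injective {η : K} (hη : η ≠ 0) (μ : Fin n → Fin k) :
    Function.Injective (tau (O := O) η μ) := by
  intro φ ψ h
  refine Subtype.ext ?_
  ext γ
  have := congrArg (fun χ : laurentRing O K k => χ.1.coeff γ) h
  exact mul_left_cancel₀ (tauFactor_ne_zero hη μ γ) this

lemma tau_tau {η : K} (hη : η ^ k = 1) (μ ν : Fin n → Fin k) (φ : laurentRing O K k) :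
    tau η μ (tau η ν φ) = tau η (μ + ν) φ := by
  refine Subtype.ext ?_
  simp only [coe_tau]
  ext γ
  simp [tauFactor_add_index hη, mul_assoc]

lemma tau_zero_index [NeZero k] (η : K) (φ : laurentRing O K k) :
    tau η (0 : Fin n → Fin k) φ = φ := by
  refine Subtype.ext ?_
  rw [coe_tau]
  ext γ
  simp [tauFactor]

lemma tau_inclusion {η : K} (hη : η ^ k = 1) (μ : Fin n → Fin k) (a : laurentRing O K 1) :
    tau η μ (Subring.inclusion (laurentRing_one_le O K k) a) =
      Subring.inclusion (laurentRing_one_le O K k) a := by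
  refine Subtype.ext ?_
  rw [coe_tau]
  ext γ
  by_cases h : a.1.coeff γ = 0
  · simp [h]
  · simp [tauFactor_eq_one hη μ (isKIntegral_of_mem a.2 γ h)]

lemma tau_bijective [NeZero k] {η : K} (hη : IsPrimitiveRoot η k) (μ : Fin n → Fin k) :
    Function.Bijective (tau (O := O) η μ) :=
  ⟨tau_injective (hη.ne_zero (NeZero.ne k)) μ, fun φ => ⟨tau η (-μ) φ, by
    rw [tau_tau hη.pow_eq_one, add_neg_cancel, tau_zero_index]⟩⟩

/-- The series fixed by all `τ_{η,μ}` have their exponents in `ℤⁿ`. -/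
lemma isKIntegral_one_of_tau_eq {η : K} (hk : 0 < k) (hη : IsPrimitiveRoot η k)
    {φ : laurentRing O K k} (h : ∀ μ : Fin n → Fin k, tau η μ φ = φ) :
    ∀ δ, φ.1.coeff δ ≠ 0 → IsKIntegral 1 δ.vec := by
  intro δ hδ
  refine isKIntegral_one_of_tauFactor_eq_one hk hη (isKIntegral_of_mem φ.2 δ hδ) fun μ => ?_
  have := congrArg (fun χ : laurentRing O K k => χ.1.coeff δ) (h μ)
  exact mul_right_cancel₀ hδ (this.trans (one_mul _).symm)

/-- The set of the conjugates `τ_{η,μ}(ζ)`. -/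
noncomputable def conjugates (η : K) (ζ : laurentRing O K k) : Finset (laurentRing O K k) :=
  open Classical in Finset.univ.image fun μ : Fin n → Fin k => tau η μ ζ

lemma mem_conjugates {η : K} {ζ β : laurentRing O K k} :
    β ∈ conjugates η ζ ↔ ∃ μ : Fin n → Fin k, tau η μ ζ = β := by
  simp [conjugates]

/-- The polynomial whose roots are the conjugates of `ζ`. -/
noncomputable def conjPoly (η : K) (ζ : laurentRing O K k) : (laurentRing O K k)[X] :=
  ∏ β ∈ conjugates η ζ, (X - C β)

lemma conjPoly_monic (η : K) (ζ : laurentRing O K k) : (conjPoly η ζ).Monic :=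
  monic_prod_of_monic _ _ fun β _ => monic_X_sub_C β

/-- `τ_{η,μ}` is injective and maps the finite set of conjugates to itself, so it permutes the
linear factors. -/
lemma conjPoly_map_tau {η : K} (hη0 : η ≠ 0) (hη : η ^ k = 1) (μ : Fin n → Fin k)
    (ζ : laurentRing O K k) : (conjPoly η ζ).map (tauHom hη0 μ) = conjPoly η ζ := by
  classical
  have himg : (conjugates η ζ).image (tau η μ) = conjugates η ζ := by
    refine Finset.eq_of_subset_of_card_le ?_
      (Finset.card_image_of_injective _ (tau_injective hη0 μ)).ge
    intro β hβ
    obtain ⟨α, hα, rfl⟩ := Finset.mem_image.mp hβ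
    obtain ⟨ν, rfl⟩ := mem_conjugates.mp hα
    exact mem_conjugates.mpr ⟨μ + ν, (tau_tau hη μ ν ζ).symm⟩
  rw [conjPoly, Polynomial.map_prod]
  conv_rhs => rw [← himg]
  rw [Finset.prod_image fun a _ b _ h => tau_injective hη0 μ h]
  simp

lemma conjPoly_coeff_isKIntegral {η : K} (hk : 0 < k) (hη : IsPrimitiveRoot η k)
    (ζ : laurentRing O K k) (i : ℕ) :
    ∀ δ, ((conjPoly η ζ).coeff i).1.coeff δ ≠ 0 → IsKIntegral 1 δ.vec := by
  refine isKIntegral_one_of_tau_eq hk hη fun μ => ?_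
  have hη0 := hη.ne_zero hk.ne'
  conv_rhs => rw [← conjPoly_map_tau hη0 hη.pow_eq_one μ ζ]
  rw [coeff_map, tauHom_apply]

/-- The target is a general domain so as to cover both roots among Hahn series and roots in
`K_⪯((X))_k` itself. -/
lemma eval_conjPoly_eq_zero_iff {η : K} {ζ : laurentRing O K k} {A : Type*} [CommRing A]
    [IsDomain A] (j : laurentRing O K k →+* A) (β : A) :
    (conjPoly η ζ).eval₂ j β = 0 ↔ ∃ μ : Fin n → Fin k, β = j (tau η μ ζ) := by
  simp only [conjPoly, eval₂_finsetProd, Finset.prod_eq_zero_iff, mem_conjugates, eval₂_sub,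
    eval₂_X, eval₂_C, sub_eq_zero]
  aesop

/-- The polynomial of the conjugates divides every polynomial over `K_⪯((X))` that has the
root `ζ`. -/
lemma conjPoly_dvd {η : K} (hη0 : η ≠ 0) (hη : η ^ k = 1) {ζ : laurentRing O K k}
    (p : (laurentRing O K 1)[X])
    (hp : p.eval₂ (Subring.inclusion (laurentRing_one_le O K k)) ζ = 0) :
    conjPoly η ζ ∣ p.map (Subring.inclusion (laurentRing_one_le O K k)) := by
  by_cases h0 : p.map (Subring.inclusion (laurentRing_one_le O K k)) = 0
  · rw [h0]
    exact dvd_zero _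
  -- The conjugates are listed without repetition, so in a domain it suffices that each one is a
  -- root.
  have : conjPoly η ζ = ((conjugates η ζ).val.map fun a => X - C a).prod := rfl
  rw [this, Multiset.prod_X_sub_C_dvd_iff_le_roots h0,
    Multiset.le_iff_subset (conjugates η ζ).nodup]
  intro β hβ
  obtain ⟨μ, rfl⟩ := mem_conjugates.mp hβ
  rw [mem_roots h0, IsRoot.def, eval_map]
  have hcomp : (tauHom hη0 μ).comp (Subring.inclusion (laurentRing_one_le O K k)) =
      Subring.inclusion (laurentRing_one_le O K k) :=
    RingHom.ext fun a => tau_inclusion hη μ a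
  have h1 := hom_eval₂ p (Subring.inclusion (laurentRing_one_le O K k)) (tauHom hη0 μ) ζ
  rw [hp, map_zero, hcomp] at h1
  exact h1.symm

end Tau

/-! ### Roots, generators of the vanishing ideal, and the Galois orbit -/

section Roots

variable {n : ℕ} {O : OrthantOrder n} {K : Type*} [Field K] {k : ℕ}

lemma exists_map_subtype_eq {R : Type*} [CommRing R] (A : Subring R) (p : R[X])
    (h : ∀ i, p.coeff i ∈ A) : ∃ q : A[X], q.map A.subtype = p :=
  (lifts_iff_coeff_lifts p).mpr fun i => ⟨⟨p.coeff i, h i⟩, rfl⟩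

lemma mem_rootsIn_iff {g : (powRing O K 1)[X]} {ξ : puiseuxRing O K} :
    ξ ∈ rootsIn O g ↔ (g.map (powRing O K 1).subtype).eval ξ.1 = 0 := by
  rw [eval_map, rootsIn, Set.mem_ofPred_eq, ← Subtype.val_injective.eq_iff]
  have := hom_eval₂ g (Subring.inclusion (powRing_one_le_puiseuxRing O K))
    (puiseuxRing O K).subtype ξ
  exact iff_of_eq (congrArg (· = 0) this)

lemma eval₂_inclusion_eq_zero_iff {g : (powRing O K 1)[X]} {ζ : laurentRing O K k} :
    ((g.map (Subring.inclusion (powRing_le_laurentRing 1))).eval₂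
      (Subring.inclusion (laurentRing_one_le O K k)) ζ = 0) ↔
      (g.map (powRing O K 1).subtype).eval ζ.1 = 0 := by
  rw [eval_map, eval₂_map, ← Subtype.val_injective.eq_iff]
  have := hom_eval₂ g ((Subring.inclusion (laurentRing_one_le O K k)).comp
    (Subring.inclusion (powRing_le_laurentRing (O := O) (K := K) 1))) (laurentRing O K k).subtype ζ
  exact iff_of_eq (congrArg (· = 0) this)

lemma rootsIn_mul (g h : (powRing O K 1)[X]) : rootsIn O (g * h) = rootsIn O g ∪ rootsIn O h := by
  ext ξ
  simp only [Set.mem_union, mem_rootsIn_iff, Polynomial.map_mul, eval_mul, mul_eq_zero]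

lemma rootsIn_eq_empty_of_isUnit {g : (powRing O K 1)[X]} (hg : IsUnit g) : rootsIn O g = ∅ := by
  refine Set.eq_empty_of_forall_notMem fun ξ hξ => ?_
  rw [mem_rootsIn_iff] at hξ
  have := (hg.map (mapRingHom (powRing O K 1).subtype)).map (evalRingHom ξ.1)
  rw [coe_mapRingHom, coe_evalRingHom, hξ] at this
  exact not_isUnit_zero this

/-- The polynomial of the conjugates has its coefficients in `K_⪯((X))`. -/
lemma exists_map_eq_conjPoly {η : K} (hk : 0 < k) (hη : IsPrimitiveRoot η k)
    (ζ : laurentRing O K k) :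
    ∃ G : (laurentRing O K 1)[X], G.Monic ∧
      G.map (Subring.inclusion (laurentRing_one_le O K k)) = conjPoly η ζ := by
  have : conjPoly η ζ ∈ lifts (Subring.inclusion (laurentRing_one_le O K k)) := by
    rw [lifts_iff_coeff_lifts]
    intro i
    -- The cone condition is inherited from `K_⪯((X))_k`; invariance under the `τ_{η,μ}` gives
    -- integral exponents.
    exact ⟨⟨((conjPoly η ζ).coeff i).1, mem_laurentRing_iff.mpr
      ⟨(mem_laurentRing_iff.mp ((conjPoly η ζ).coeff i).2).1,
        conjPoly_coeff_isKIntegral hk hη ζ i⟩⟩, rfl⟩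
  obtain ⟨G, hG, -, hm⟩ := lifts_and_natDegree_eq_and_monic this (conjPoly_monic η ζ)
  exact ⟨G, hm, hG⟩

/-- A polynomial over `K_⪯[[X]]` that has the root `ζ` is a multiple over `K_⪯((X))` of the
polynomial of the conjugates. -/
lemma exists_map_eq_conjPoly_mul {η : K} (hk : 0 < k) (hη : IsPrimitiveRoot η k)
    {ζ : laurentRing O K k} {p : (powRing O K 1)[X]}
    (hp : (p.map (powRing O K 1).subtype).eval ζ.1 = 0) :
    ∃ q : (laurentRing O K 1)[X], p.map (powRing O K 1).subtype =
      (conjPoly η ζ).map (laurentRing O K k).subtype * q.map (laurentRing O K 1).subtype := by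
  obtain ⟨G, hGm, hG⟩ := exists_map_eq_conjPoly hk hη ζ
  have h := conjPoly_dvd (hη.ne_zero hk.ne') hη.pow_eq_one _ (eval₂_inclusion_eq_zero_iff.mpr hp)
  -- Divisibility by a monic polynomial descends to a subring.
  rw [← hG, map_dvd_map _ (Subring.inclusion_injective _) hGm] at h
  obtain ⟨q, hq⟩ := h
  refine ⟨q, ?_⟩
  have h1 := congrArg (Polynomial.map (laurentRing O K 1).subtype) hq
  rw [Polynomial.map_mul, Polynomial.map_map] at h1
  rw [← hG, Polynomial.map_map]
  exact h1

lemma rootsIn_eq_tauOrbit {η : K} (hk : 0 < k) {ζ : laurentRing O K k} {g : (powRing O K 1)[X]}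
    {u : HahnSeries (Exponent O) K} (hu : u ≠ 0)
    (hg : g.map (powRing O K 1).subtype =
      C u * (conjPoly η ζ).map (laurentRing O K k).subtype) :
    rootsIn O g = tauOrbit hk η ζ := by
  ext β
  rw [mem_rootsIn_iff, hg, eval_mul, eval_C, mul_eq_zero, or_iff_right hu, eval_map,
    eval_conjPoly_eq_zero_iff]
  exact exists_congr fun μ => ⟨fun h => Subtype.ext h, fun h => congrArg Subtype.val h⟩

/-- If `ζ` is integral over `K_⪯[[X]]`, the polynomials over `K_⪯[[X]]` with the root `ζ` are the
multiples of the polynomial of the conjugates. -/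
lemma exists_generator_of_mem_powRing {η : K} (hk : 0 < k) (hη : IsPrimitiveRoot η k)
    {ζ : laurentRing O K k} (hζ : ζ.1 ∈ powRing O K k) :
    ∃ g : (powRing O K 1)[X], rootsIn O g = tauOrbit hk η ζ ∧
      ∀ p : (powRing O K 1)[X], (p.map (powRing O K 1).subtype).eval ζ.1 = 0 → g ∣ p := by
  -- Twisting does not enlarge supports, so the cone of `ζ` serves all conjugates.
  have hconj : ∀ β ∈ conjugates η ζ, β.1 ∈ powRing O K k := by
    intro β hβ
    obtain ⟨μ, rfl⟩ := mem_conjugates.mp hβ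
    obtain ⟨σ, hσ, h⟩ := hζ
    exact ⟨σ, hσ, fun γ hγ => h γ (right_ne_zero_of_mul hγ)⟩
  have hlift : (conjPoly η ζ).map (laurentRing O K k).subtype ∈
      lifts (powRing O K k).subtype := by
    rw [conjPoly, Polynomial.map_prod]
    refine (lifts (powRing O K k).subtype).prod_mem fun β hβ => ?_
    rw [lifts_iff_coeff_lifts]
    intro i
    refine ⟨(X - C (⟨β.1, hconj β hβ⟩ : powRing O K k)).coeff i, ?_⟩
    rw [← coeff_map]
    simp
  obtain ⟨g, hg⟩ := exists_map_subtype_eq (powRing O K 1)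
    ((conjPoly η ζ).map (laurentRing O K k).subtype) fun i => by
      refine mem_powRing_one_of_mem (k := k) ?_ ?_
      · obtain ⟨a, ha⟩ := (lifts_iff_coeff_lifts _).mp hlift i
        rw [← ha]
        exact a.2
      · rw [coeff_map]
        exact conjPoly_coeff_isKIntegral hk hη ζ i
  have hgm : g.Monic := monic_of_injective (Subring.subtype_injective _) (by
    rw [hg]
    exact (conjPoly_monic η ζ).map _)
  refine ⟨g, rootsIn_eq_tauOrbit hk one_ne_zero (by rw [hg, C_1, one_mul]), fun p hp => ?_⟩
  obtain ⟨q, hq⟩ := exists_map_eq_conjPoly_mul hk hη hp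
  rw [← map_dvd_map _ (Subring.subtype_injective _) hgm, hg, hq]
  exact dvd_mul_right _ _

lemma monom_mem_laurentRing (γ : Fin n → ℤ) : monom O K γ ∈ laurentRing O K k :=
  ⟨-γ, by
    rw [← monom_add, neg_add_cancel, monom_zero]
    exact one_mem _⟩

/-- For a vector space order, the polynomials over `K_⪯[[X]]` with the root `ζ` are the multiples
of the primitive polynomial proportional to the polynomial of the conjugates. -/
lemma exists_generator_of_isVectorOrder (hO : O.IsVectorOrder) {η : K} (hk : 0 < k)
    (hη : IsPrimitiveRoot η k) (ζ : laurentRing O K k) :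
    ∃ g : (powRing O K 1)[X], rootsIn O g = tauOrbit hk η ζ ∧
      ∀ p : (powRing O K 1)[X], (p.map (powRing O K 1).subtype).eval ζ.1 = 0 → g ∣ p := by
  obtain ⟨G, hGm, hG⟩ := exists_map_eq_conjPoly hk hη ζ
  set P := (conjPoly η ζ).map (laurentRing O K k).subtype with hP
  have hPG : P = G.map (laurentRing O K 1).subtype := by
    rw [hP, ← hG, Polynomial.map_map]
    rfl
  have hP0 : P ≠ 0 := ((conjPoly_monic η ζ).map _).ne_zero
  obtain ⟨j, hj, hmin⟩ := P.support.exists_min_image (fun i => (P.coeff i).order)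
    (support_nonempty.mpr hP0)
  have hj0 : (P.coeff j).coeff (P.coeff j).order ≠ 0 :=
    HahnSeries.coeff_order_eq_zero.not.mpr (mem_support_iff.mp hj)
  -- The least order is an integral exponent because `P` lies over `K_⪯((X))`; so `X^{-γ} P` still
  -- does, and it is primitive.
  obtain ⟨γ, hγ⟩ : ∃ γ, intExponent O γ = (P.coeff j).order := by
    have hPj : P.coeff j ∈ laurentRing O K 1 := by
      rw [hPG, coeff_map]
      exact (G.coeff j).2
    choose γ hγ using isKIntegral_of_mem hPj _ hj0
    refine ⟨γ, funext fun i => ?_⟩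
    have := hγ i
    rw [Nat.cast_one, one_mul] at this
    exact this.symm
  have hneg : intExponent O (-γ) = -(P.coeff j).order := by
    rw [← hγ]
    funext i
    change (((-γ) i : ℤ) : ℚ) = -((γ i : ℤ) : ℚ)
    simp
  have hcoeff : ∀ i δ, ((C (monom O K (-γ)) * P).coeff i).coeff δ =
      (P.coeff i).coeff (δ + (P.coeff j).order) := by
    intro i δ
    rw [coeff_C_mul, monom_mul_coeff, hneg, sub_neg_eq_add]
  have hnonneg : ∀ i δ, ((C (monom O K (-γ)) * P).coeff i).coeff δ ≠ 0 → 0 ≤ δ := by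
    intro i δ hδ
    rw [hcoeff] at hδ
    have hi : i ∈ P.support := by
      rw [mem_support_iff]
      rintro h0
      simp [h0] at hδ
    simpa using (hmin i hi).trans (HahnSeries.order_le_of_coeff_ne_zero hδ)
  obtain ⟨g, hg⟩ := exists_map_subtype_eq (powRing O K 1) (C (monom O K (-γ)) * P) fun i =>
    hO.mem_powRing one_pos (by
      rw [coeff_C_mul, hPG, coeff_map]
      exact mul_mem (monom_mem_laurentRing _) (G.coeff i).2) (hnonneg i)
  have hmm : monom O K (-γ) * monom O K γ = 1 := by
    rw [← monom_add, neg_add_cancel, monom_zero]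
  refine ⟨g, rootsIn_eq_tauOrbit hk (left_ne_zero_of_mul_eq_one hmm) hg, fun p hp => ?_⟩
  obtain ⟨q, hq⟩ := exists_map_eq_conjPoly_mul hk hη hp
  have hprod : p.map (powRing O K 1).subtype = (C (monom O K (-γ)) * P) *
      (C (monom O K γ) * q.map (laurentRing O K 1).subtype) := by
    rw [mul_mul_mul_comm, ← C_mul, hmm, C_1, one_mul, hq]
  -- Gauss's lemma: `X^{-γ} P` is primitive and `p` has non-negative exponents, hence so does the
  -- quotient.
  have hq_nonneg := nonneg_of_mul_nonneg hnonneg ⟨j, by rwa [hcoeff, zero_add]⟩ (by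
    rw [← hprod]
    intro i δ hδ
    rw [coeff_map] at hδ
    obtain ⟨σ, hσ, h⟩ := (p.coeff i).2
    have := hσ.2 _ (h δ hδ).1
    rw [← realVec_zero] at this
    exact this)
  obtain ⟨r, hr⟩ := exists_map_subtype_eq (powRing O K 1) _ fun i =>
    hO.mem_powRing one_pos (by
      rw [coeff_C_mul, coeff_map]
      exact mul_mem (monom_mem_laurentRing _) (q.coeff i).2) (hq_nonneg i)
  refine ⟨r, map_injective _ (Subring.subtype_injective _) ?_⟩
  rw [Polynomial.map_mul, hg, hr, hprod]

/-- A root of a polynomial that splits over `K_⪯[[X]]_k` is a root of a factor of degree one. -/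
lemma FactorsIn.exists_linear {f : (MvPowerSeries (Fin n) K)[X]} (hf0 : f ≠ 0)
    (hfk : FactorsIn O f k) {ξ : puiseuxRing O K} (hξ : ξ ∈ rootsIn O (f.map (ofSeries O K))) :
    ∃ a b : powRing O K k, a ≠ 0 ∧ a.1 * ξ.1 = b.1 ∧ (f.Monic → IsUnit a) := by
  obtain ⟨s, hs, hprod⟩ := hfk
  have hne : s.prod ≠ 0 := by
    rw [← hprod, Ne, Polynomial.map_eq_zero_iff (Subring.inclusion_injective _),
      Polynomial.map_eq_zero_iff ofSeries_injective]
    exact hf0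
  have hroot : (s.prod.map (powRing O K k).subtype).eval ξ.1 = 0 := by
    rw [mem_rootsIn_iff] at hξ
    rw [← hprod, Polynomial.map_map]
    exact hξ
  rw [← coe_mapRingHom, ← coe_evalRingHom, map_multiset_prod, map_multiset_prod,
    Multiset.prod_eq_zero_iff] at hroot
  simp only [Multiset.map_map, Multiset.mem_map, Function.comp_apply, coe_mapRingHom,
    coe_evalRingHom] at hroot
  obtain ⟨p, hp, hp0⟩ := hroot
  have hpX := eq_X_add_C_of_natDegree_le_one (hs p hp)
  have heval : (p.coeff 1).1 * ξ.1 + (p.coeff 0).1 = 0 := by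
    rw [hpX] at hp0
    simpa using hp0
  -- A constant factor vanishing at `ξ` would be zero, and then `f` would be zero.
  have h1 : p.coeff 1 ≠ 0 := by
    intro h1
    have h0 : p.coeff 0 = 0 := Subtype.ext (by simpa [h1] using heval)
    refine hne (Multiset.prod_eq_zero ?_)
    rw [h1, h0, C_0, zero_mul, add_zero] at hpX
    rwa [← hpX]
  refine ⟨p.coeff 1, -p.coeff 0, h1, by
    rw [Subring.coe_neg]
    exact eq_neg_of_add_eq_zero_left heval, fun hm => ?_⟩
  have hlead : p.coeff 1 = p.leadingCoeff := by
    rw [leadingCoeff, natDegree_eq_of_le_of_coeff_ne_zero (hs p hp) h1]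
  -- For monic `f` the leading coefficients of the factors multiply to `1`, so each is a unit.
  have hsm : s.prod.Monic := by
    rw [← hprod]
    exact (hm.map _).map _
  rw [hlead]
  refine isUnit_of_dvd_one ?_
  rw [← hsm.leadingCoeff]
  obtain ⟨q, hq⟩ := Multiset.dvd_prod hp
  rw [hq, leadingCoeff_mul]
  exact dvd_mul_right _ _

/-- The roots of a polynomial that splits over `K_⪯[[X]]_k` lie in `K_⪯((X))_k`. -/
lemma FactorsIn.mem_laurentRing {f : (MvPowerSeries (Fin n) K)[X]} (hf0 : f ≠ 0)
    (hfk : FactorsIn O f k) {ξ : puiseuxRing O K} (hξ : ξ ∈ rootsIn O (f.map (ofSeries O K))) :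
    ξ.1 ∈ laurentRing O K k := by
  obtain ⟨a, b, ha, hab, -⟩ := hfk.exists_linear hf0 hξ
  obtain ⟨γ, l, -, hl⟩ := ξ.2
  -- Membership in `𝒮_⪯` supplies the cone, for some denominator `l`; the relation `aξ = b` replaces
  -- `l` by `k`.
  refine mem_laurentRing_iff.mpr ⟨((mem_laurentRing_iff (k := l)).mp ⟨γ, hl⟩).1, ?_⟩
  exact isKIntegral_of_mul (fun h => ha (Subtype.ext h))
    (isKIntegral_of_mem (powRing_le_laurentRing k a.2))
    (isKIntegral_of_mem (powRing_le_laurentRing k b.2)) hab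

/-- The roots of a monic polynomial that splits over `K_⪯[[X]]_k` lie in `K_⪯[[X]]_k`. -/
lemma FactorsIn.mem_powRing {f : (MvPowerSeries (Fin n) K)[X]} (hf : f.Monic)
    (hfk : FactorsIn O f k) {ξ : puiseuxRing O K} (hξ : ξ ∈ rootsIn O (f.map (ofSeries O K))) :
    ξ.1 ∈ powRing O K k := by
  obtain ⟨a, b, -, hab, ha⟩ := hfk.exists_linear hf.ne_zero hξ
  obtain ⟨c, hc⟩ := (ha hf).exists_left_inv
  have h1 : c.1 * a.1 = 1 := congrArg Subtype.val hc
  have h2 : ξ.1 = c.1 * b.1 := by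
    rw [← hab, ← mul_assoc, h1, one_mul]
  rw [h2]
  exact mul_mem c.2 b.2

/-- The conjugates of `ζ` are its images under the automorphisms over `K_⪯((X))`. -/
lemma tauOrbit_eq_galoisOrbit {η : K} (hk : 0 < k) (hη : IsPrimitiveRoot η k)
    (ζ : laurentRing O K k) : tauOrbit hk η ζ = galoisOrbit hk ζ := by
  have : NeZero k := ⟨hk.ne'⟩
  ext β
  constructor
  · rintro ⟨μ, rfl⟩
    exact ⟨RingEquiv.ofBijective (tauHom (hη.ne_zero hk.ne') μ) (tau_bijective hη μ),
      tau_inclusion hη.pow_eq_one μ, rfl⟩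
  · rintro ⟨s, hs, rfl⟩
    -- An automorphism `s` fixes the coefficients of `G`, so `s ζ` is again a root of `G`, hence a
    -- conjugate.
    obtain ⟨G, -, hG⟩ := exists_map_eq_conjPoly hk hη ζ
    have h1 : G.eval₂ (Subring.inclusion (laurentRing_one_le O K k)) ζ = 0 := by
      rw [← eval_map, hG, ← eval₂_id, eval_conjPoly_eq_zero_iff]
      exact ⟨0, (tau_zero_index η ζ).symm⟩
    have hcomp : (s : laurentRing O K k →+* laurentRing O K k).comp
        (Subring.inclusion (laurentRing_one_le O K k)) =
          Subring.inclusion (laurentRing_one_le O K k) := RingHom.ext hs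
    have h2 := hom_eval₂ G (Subring.inclusion (laurentRing_one_le O K k))
      (s : laurentRing O K k →+* laurentRing O K k) ζ
    rw [h1, map_zero, hcomp, ← eval_map, hG, ← eval₂_id, eq_comm, eval_conjPoly_eq_zero_iff] at h2
    obtain ⟨μ, hμ⟩ := h2
    exact ⟨μ, congrArg _ hμ⟩

end Roots

end ConeSeries

/-! ### The theorem on branches -/

theorem mainTheorem2 {K : Type*} [Field K] [IsAlgClosed K] [CharZero K] {n : ℕ}
    (O : ConeSeries.OrthantOrder n) (f : Polynomial (MvPowerSeries (Fin n) K)) (hf0 : f ≠ 0)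
    (hf : f.Monic ∨ O.IsVectorOrder)
    (ξ : ConeSeries.puiseuxRing O K)
    (hξ : ξ ∈ ConeSeries.rootsIn O (f.map (ConeSeries.ofSeries O K)))
    (k : ℕ) (hk : 0 < k) (hfk : ConeSeries.FactorsIn O f k)
    (η : K) (hη : IsPrimitiveRoot η k) :
    ∃ ζ : ConeSeries.laurentRing O K k,
      Subring.inclusion (ConeSeries.laurentRing_le_puiseuxRing O K hk) ζ = ξ ∧
      (∀ B : Set (ConeSeries.puiseuxRing O K),
        (ConeSeries.IsBranch O f B ∧ ξ ∈ B) ↔ B = ConeSeries.tauOrbit hk η ζ) ∧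
      ConeSeries.tauOrbit hk η ζ = ConeSeries.galoisOrbit hk ζ := by
  open ConeSeries in
  have : NeZero k := ⟨hk.ne'⟩
  let ζ : laurentRing O K k := ⟨ξ.1, hfk.mem_laurentRing hf0 hξ⟩
  refine ⟨ζ, rfl, ?_, tauOrbit_eq_galoisOrbit hk hη ζ⟩
  obtain ⟨g, hgroots, hgdvd⟩ : ∃ g : Polynomial (powRing O K 1), rootsIn O g = tauOrbit hk η ζ ∧
      ∀ p : Polynomial (powRing O K 1), ξ ∈ rootsIn O p → g ∣ p := by
    simp only [mem_rootsIn_iff]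
    rcases hf with hf | hO
    · exact exists_generator_of_mem_powRing hk hη (ζ := ζ) (hfk.mem_powRing hf hξ)
    · exact exists_generator_of_isVectorOrder hO hk hη ζ
  have hξB : ξ ∈ rootsIn O g := by
    rw [hgroots]
    exact ⟨0, congrArg (Subring.inclusion _) (tau_zero_index η ζ).symm⟩
  have hgunit : ¬ IsUnit g := fun h => by
    rw [rootsIn_eq_empty_of_isUnit h] at hξB
    exact hξB
  have hg0 : g ≠ 0 := by
    rintro rfl
    have h := zero_dvd_iff.mp (hgdvd _ hξ)
    rw [Polynomial.map_eq_zero_iff ofSeries_injective] at h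
    exact hf0 h
  -- Vanishing at `ξ` is a prime condition, since series form a domain, and it is equivalent to
  -- divisibility by `g`.
  have hgprime : Prime g := by
    refine ⟨hg0, hgunit, fun a b hab => ?_⟩
    obtain ⟨c, hc⟩ := hab
    have h : ξ ∈ rootsIn O (a * b) := by
      rw [hc, rootsIn_mul]
      exact Or.inl hξB
    rw [rootsIn_mul] at h
    exact h.imp (hgdvd a) (hgdvd b)
  intro B
  rw [← hgroots]
  constructor
  · rintro ⟨⟨p, hp, -, rfl⟩, hξp⟩
    -- As `g` is not a unit, irreducibility of `g * c` makes `c` a unit, which has no roots.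
    obtain ⟨c, rfl⟩ := hgdvd p hξp
    rw [rootsIn_mul, rootsIn_eq_empty_of_isUnit ((hp.isUnit_or_isUnit rfl).resolve_left hgunit),
      Set.union_empty]
  · rintro rfl
    exact ⟨⟨g, hgprime.irreducible, hgdvd _ hξ, rfl⟩, hξB⟩
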